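/- Let $B_R=\{x\in\mathbb R^3:|x|<R\}$. For a vector field $\mathbf u$ on $\mathbb R^3$ put $$\mathbf u_N=\Big(\mathbf u\cdot\frac{x}{|x|}\Big)\frac{x}{|x|},\qquad \mathbf u_T=\mathbf u-\mathbf u_N .$$ Let $\alpha\le 1$ be a real number and let $\mathbf u\in W^{1,3/2}_{\mathrm{loc}}(\mathbb R^3,\mathbb R^3)$ be a weak Beltrami flow, that is, $\operatorname{curl}\mathbf u\times\mathbf u=\mathbf 0$ and $\operatorname{div}\mathbf u=0$ almost everywhere in $\mathbb R^3$, where curl and divergence are formed with the weak derivatives of $\mathbf u$. Then for every $R>0$ the field $\mathbf u$ has a trace on $\partial B_R$, this trace belongs to $L^2(\partial B_R)$, the functions $|\mathbf u|^2/|x|^\alpha$ and $|\mathbf u_N|^2/|x|^\alpha$ are integrable on $B_R$, and $$\frac{\alpha-1}{2}\int_{B_R}\frac{|\mathbf u|^2}{|x|^\alpha}\,dx+\frac R2\int_{\partial B_R}\frac{|\mathbf u|^2}{|x|^\alpha}\,dS =\alpha\int_{B_R}\frac{|\mathbf u_N|^2}{|x|^\alpha}\,dx+R\int_{\partial B_R}\frac{|\mathbf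 u_N|^2}{|x|^\alpha}\,dS .$$ Moreover, if $\alpha=1$, then for every $R>0$ $$\int_{B_R}\frac{|\mathbf u_N|^2}{|x|}\,dx=\frac1{R^2}\int_{B_R}|x|\,|\mathbf u_T|^2\,dx=\frac1{2R}\int_{B_R}|\mathbf u|^2\,dx=\frac12\int_{\partial B_R}\big(|\mathbf u_T|^2-|\mathbf u_N|^2\big)\,dS ,$$ where all the integrands are integrable. In the integrals over $\partial B_R$ the values of $\mathbf u$ are those of its trace, and $dS$ is the surface measure. -/

import Mathlib

open MeasureTheory Filter Topology Metric
open scoped ENNReal ContDiff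

noncomputable section

/-- Three-dimensional Euclidean space. -/
abbrev E3 : Type := EuclideanSpace ℝ (Fin 3)

namespace Beltrami

/-- The standard basis vector `e i`. -/
def e (i : Fin 3) : E3 := EuclideanSpace.single i (1 : ℝ)

/-- The cross product of two vectors. -/
def cross (a b : E3) : E3 := WithLp.toLp 2 (crossProduct a.ofLp b.ofLp)

/-- The divergence `∑ i, ∂ i (u i)` at a point, read off from the derivative `A = Du(x)`,
for which `A (e i) j = ∂ i (u j)`. -/
def divOf (A : E3 →L[ℝ] E3) : ℝ := ∑ i, A (e i) i

/-- The curl at a point, read off from the derivative `A = Du(x)`. -/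
def curlOf (A : E3 →L[ℝ] E3) : E3 :=
  !₂[A (e 1) 2 - A (e 2) 1, A (e 2) 0 - A (e 0) 2, A (e 0) 1 - A (e 1) 0]

/-- `G` is the weak (distributional) derivative of the vector field `u` on the whole space. -/
structure HasWeakDeriv (u : E3 → E3) (G : E3 → (E3 →L[ℝ] E3)) : Prop where
  locallyIntegrable : LocallyIntegrable u volume
  locallyIntegrable_deriv : LocallyIntegrable G volume
  integral_eq : ∀ φ : E3 → ℝ, ContDiff ℝ ∞ φ → HasCompactSupport φ → ∀ v : E3,
    ∫ x, (fderiv ℝ φ x v) • u x = - ∫ x, φ x • G x v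

/-- `f` is in `L^p` on every compact set. -/
def MemLpLoc {F : Type*} [NormedAddCommGroup F] (f : E3 → F) (p : ℝ≥0∞) : Prop :=
  ∀ K : Set E3, IsCompact K → MemLp f p (volume.restrict K)

/-- Weak solutions of `curl u × u = 0`, `div u = 0` on the whole space: `u` belongs to
`W^{1,3/2}_loc`, and its weak derivative satisfies both equations almost everywhere. -/
def IsWeakBeltramiFlow (u : E3 → E3) : Prop :=
  ∃ G : E3 → (E3 →L[ℝ] E3), HasWeakDeriv u G ∧ MemLpLoc u (3 / 2) ∧ MemLpLoc G (3 / 2) ∧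
    (∀ᵐ x, cross (curlOf (G x)) (u x) = 0) ∧ (∀ᵐ x, divOf (G x) = 0)

/-- The surface measure `dS` of the sphere of radius `R` about the origin, as a measure on the
whole space: the surface measure of the unit sphere, transported by `y ↦ R y` and multiplied
by `R ^ 2`. -/
def surfaceMeasure (R : ℝ) : Measure E3 :=
  ENNReal.ofReal (R ^ 2) •
    ((volume : Measure E3).toSphere).map (fun y : sphere (0 : E3) 1 => R • (y : E3))

/-- `g` is the trace on the sphere of radius `R` about the origin of the restriction of `u` to
the ball, in the sense of `W^{1,p}`: `g` is the `L^p`-limit on the sphere of the restrictions of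
smooth vector fields that converge to `u` in `W^{1,p}` of the ball. -/
def IsSphereTrace (p : ℝ≥0∞) (u : E3 → E3) (R : ℝ) (g : E3 → E3) : Prop :=
  MemLp g p (surfaceMeasure R) ∧
  ∃ G : E3 → (E3 →L[ℝ] E3), HasWeakDeriv u G ∧
  ∃ w : ℕ → E3 → E3, (∀ n, ContDiff ℝ ∞ (w n)) ∧
    Tendsto (fun n => eLpNorm (fun x => w n x - u x) p (volume.restrict (ball 0 R)))
      atTop (𝓝 0) ∧
    Tendsto (fun n => eLpNorm (fun x => fderiv ℝ (w n) x - G x) p (volume.restrict (ball 0 R)))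
      atTop (𝓝 0) ∧
    Tendsto (fun n => eLpNorm (fun x => w n x - g x) p (surfaceMeasure R)) atTop (𝓝 0)

/-- The normal part `(u · x/|x|) x/|x|` of a vector field. -/
def normalPart (u : E3 → E3) (x : E3) : E3 :=
  (inner ℝ (u x) (‖x‖⁻¹ • x)) • (‖x‖⁻¹ • x)

/-- The tangential part `u - u_N` of a vector field. -/
def tangentialPart (u : E3 → E3) (x : E3) : E3 := u x - normalPart u x

end Beltrami

end

noncomputable section

namespace Beltrami

/-! ### Polar coordinates and integrals over spheres -/

/-! For smooth `u`, the field `(div u) u + curl u × u` is the divergence of the stress tensor `u ⊗ u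
- (|u|²/2) I`, so for a Beltrami flow this tensor is divergence free. Contracting it with a radial
field `m x`, where `∇m = k x`, gives the vector field `m (u · x) u - (m |u|²/2) x`, whose divergence
is `k (u · x)² - (k |x|² + m) |u|²/2`. For `m = |x|^(-α)` this equals `((α - 1)/2 |u|² - α |u_N|²)
|x|^(-α)`, and the divergence theorem on the ball is the weighted identity. The work lies in the low
regularity of `u` and in the singularity of the weight at the origin.

Regularity: in dimension three `W^{1,3/2}` embeds locally in `L³`, and `2/3 + 1/3 = 1`, so products
of `u` with its derivative are locally integrable and depend continuously on the field. All
identities are proved for smooth fields (`integral_norm_sq_radial`, `integral_stress`) and passed to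
the limit along mollifications of a truncation of `u` (`exists_smooth_approximation`,
`tendsto_integral_bilinear`). The same pairing yields the `L²` trace: the divergence of `|v|² x`
controls `∫ |v|² dS` by `∫ |v|²` and `∫ |v| |Dv|`, so the approximations are Cauchy in `L²` of the
sphere (`tendsto_eLpNorm_surface_sub`). Uniqueness of the trace, from the bound
`eLpNorm_one_surface_le`, carries the results over to any trace.

Singularity: the weight is replaced by `(|x|² + ε²)^(-α/2)`. The divergence of `|u|² m x` with
exponent `-1/2` gives a bound uniform in `ε`, and Fatou's lemma gives `|u|²/|x| ∈ L¹`
(`SmoothApprox.integrableOn_norm_sq_div`). This function, together with `|u|²`, dominates the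
regularized integrands, so `ε → 0` is allowed (`SmoothApprox.weighted_identity`).

The chain of equalities combines the identity for `α = 1`, `0` and `-1`: the boundary enters each of
them only through one and the same integral of `|u_N|² - |u|²/2`. -/

/-- The surface measure of the unit sphere. -/
abbrev sphereMeasure : Measure (sphere (0 : E3) 1) := (volume : Measure E3).toSphere

lemma measurableEmbedding_smul_sphere {R : ℝ} (hR : 0 < R) :
    MeasurableEmbedding (fun y : sphere (0 : E3) 1 => R • (y : E3)) :=
  (Homeomorph.smulOfNeZero R hR.ne').measurableEmbedding.comp
    (MeasurableEmbedding.subtype_coe isClosed_sphere.measurableSet)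

lemma integral_surfaceMeasure {F : Type*} [NormedAddCommGroup F] [NormedSpace ℝ F]
    {R : ℝ} (hR : 0 < R) (f : E3 → F) :
    ∫ x, f x ∂(surfaceMeasure R) = R ^ 2 • ∫ y, f (R • (y : E3)) ∂sphereMeasure := by
  rw [surfaceMeasure, integral_smul_measure, (measurableEmbedding_smul_sphere hR).integral_map,
    ENNReal.toReal_ofReal (by positivity)]

instance isFiniteMeasure_surfaceMeasure (R : ℝ) : IsFiniteMeasure (surfaceMeasure R) := by
  unfold surfaceMeasure
  exact Measure.smul_finite _ ENNReal.ofReal_ne_top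

lemma ae_surfaceMeasure_norm_eq {R : ℝ} (hR : 0 < R) : ∀ᵐ x ∂(surfaceMeasure R), ‖x‖ = R := by
  unfold surfaceMeasure
  refine Measure.ae_smul_measure ?_ _
  rw [(measurableEmbedding_smul_sphere hR).ae_map_iff]
  refine Eventually.of_forall fun y => ?_
  simp [norm_smul, abs_of_pos hR]

/-- Polar coordinates identify the punctured space with the product of the unit sphere and the
half-line, the latter with density `r²`; the missing origin is a null set. Fubini does the rest. -/
lemma integral_polar {h : E3 → ℝ} (hh : Integrable h) :
    ∫ x, h x = ∫ r in Set.Ioi (0 : ℝ), r ^ 2 * ∫ y, h (r • (y : E3)) ∂sphereMeasure := by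
  have hd : Module.finrank ℝ E3 - 1 = 2 := by simp
  have hmp := (volume : Measure E3).measurePreserving_homeomorphUnitSphereProd
  rw [hd] at hmp
  set g : sphere (0 : E3) 1 × Set.Ioi (0 : ℝ) → ℝ := fun z => h (z.2.1 • (z.1 : E3)) with hg
  have hgh : ∀ x : ({(0 : E3)}ᶜ : Set E3), g (homeomorphUnitSphereProd E3 x) = h x := by
    intro x
    have hx : (x : E3) ≠ 0 := x.2
    simp [hg, smul_smul, hx]
  have hgi : Integrable g (sphereMeasure.prod (Measure.volumeIoiPow 2)) := by
    rw [← hmp.integrable_comp_emb (Homeomorph.measurableEmbedding _)]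
    have : (g ∘ (homeomorphUnitSphereProd E3)) = h ∘ ((↑) : ({(0 : E3)}ᶜ : Set E3) → E3) := by
      ext x; exact hgh x
    rw [this]
    rw [← integrableOn_iff_comap_subtypeVal (measurableSet_singleton _).compl]
    exact hh.integrableOn
  calc ∫ x, h x = ∫ x : ({(0 : E3)}ᶜ : Set E3), h x ∂(volume.comap Subtype.val) := by
        rw [integral_subtype_comap (measurableSet_singleton (0 : E3)).compl (fun x => h x),
          restrict_compl_singleton]
    _ = ∫ z, g z ∂(sphereMeasure.prod (Measure.volumeIoiPow 2)) := by
        rw [← hmp.integral_comp (Homeomorph.measurableEmbedding _)]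
        simp_rw [hgh]
    _ = ∫ r, ∫ y, g (y, r) ∂sphereMeasure ∂(Measure.volumeIoiPow 2) := by
        rw [integral_prod_symm _ hgi]
    _ = _ := by
        simp only [Measure.volumeIoiPow, ENNReal.ofReal]
        rw [integral_withDensity_eq_integral_smul,
          ← integral_subtype_comap measurableSet_Ioi
            (fun r : ℝ => r ^ 2 * ∫ y, h (r • (y : E3)) ∂sphereMeasure)]
        · refine integral_congr_ae (Eventually.of_forall fun r => ?_)
          have : 0 ≤ (r : ℝ) ^ 2 := by positivity
          simp only [hg, NNReal.smul_def, Real.coe_toNNReal _ this, smul_eq_mul]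
        · exact (measurable_subtype_coe.pow_const _).real_toNNReal

lemma integral_annulus {h : E3 → ℝ} (hh : Continuous h) {a b : ℝ} (ha : 0 ≤ a) (hab : a ≤ b) :
    ∫ x in {x : E3 | a < ‖x‖ ∧ ‖x‖ ≤ b}, h x
      = ∫ r in a..b, r ^ 2 * ∫ y, h (r • (y : E3)) ∂sphereMeasure := by
  have hm : MeasurableSet {x : E3 | a < ‖x‖ ∧ ‖x‖ ≤ b} :=
    (measurableSet_lt measurable_const measurable_norm).inter
      (measurableSet_le measurable_norm measurable_const)
  have hi : IntegrableOn h {x : E3 | a < ‖x‖ ∧ ‖x‖ ≤ b} :=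
    (hh.continuousOn.integrableOn_compact (isCompact_closedBall (0 : E3) b)).mono_set
      fun x hx => by simpa using hx.2
  rw [← integral_indicator hm, integral_polar ((integrable_indicator_iff hm).2 hi),
    intervalIntegral.integral_of_le hab, ← integral_indicator measurableSet_Ioi,
    ← integral_indicator measurableSet_Ioc]
  congr 1
  ext r
  by_cases hr : 0 < r
  · have hn : ∀ y : sphere (0 : E3) 1, ‖r • (y : E3)‖ = r := fun y => by
      simp [norm_smul, abs_of_pos hr]
    by_cases hr2 : a < r ∧ r ≤ b
    · simp [Set.indicator, hr, hn, hr2]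
    · simp [Set.indicator, hr, hn, hr2]
  · have : ¬ (a < r) := by linarith
    simp [Set.indicator, hr, this]

lemma continuous_sphere_average {h : E3 → ℝ} (hh : Continuous h) :
    Continuous fun r : ℝ => r ^ 2 * ∫ y, h (r • (y : E3)) ∂sphereMeasure := by
  refine (continuous_pow 2).mul ?_
  have : Continuous fun r : ℝ => ∫ y in (Set.univ : Set (sphere (0 : E3) 1)),
      h (r • (y : E3)) ∂sphereMeasure := by
    refine continuous_parametric_integral_of_continuous ?_ isCompact_univ
    fun_prop
  simpa using this

/-! ### The divergence theorem on a ball -/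

/-- The Lipschitz cutoff equal to `1` on the ball of radius `R - δ` and to `0` outside the ball of
radius `R`. -/
def radialCutoff (R δ : ℝ) (x : E3) : ℝ := max 0 (min 1 (δ⁻¹ * (R - ‖x‖)))

lemma lipschitzWith_radialCutoff (R δ : ℝ) :
    LipschitzWith (Real.nnabs δ⁻¹) (radialCutoff R δ) := by
  have h1 : LipschitzWith (Real.nnabs δ⁻¹) fun x : E3 => δ⁻¹ * (R - ‖x‖) := by
    refine LipschitzWith.of_dist_le_mul fun x y => ?_
    rw [Real.dist_eq, ← mul_sub, abs_mul, Real.coe_nnabs]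
    refine mul_le_mul_of_nonneg_left ?_ (abs_nonneg _)
    have h := abs_norm_sub_norm_le y x
    rwa [show R - ‖x‖ - (R - ‖y‖) = ‖y‖ - ‖x‖ by ring, dist_comm, dist_eq_norm]
  exact (h1.const_min 1).const_max 0

lemma radialCutoff_of_ge {R δ : ℝ} (hδ : 0 < δ) {x : E3} (hx : R ≤ ‖x‖) :
    radialCutoff R δ x = 0 := by
  unfold radialCutoff
  have : δ⁻¹ * (R - ‖x‖) ≤ 0 :=
    mul_nonpos_of_nonneg_of_nonpos (by positivity) (by linarith)
  exact max_eq_left ((min_le_right _ _).trans this)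

lemma radialCutoff_of_le {R δ : ℝ} (hδ : 0 < δ) {x : E3} (hx : ‖x‖ ≤ R - δ) :
    radialCutoff R δ x = 1 := by
  unfold radialCutoff
  have : 1 ≤ δ⁻¹ * (R - ‖x‖) := by
    rw [inv_mul_eq_div, le_div_iff₀ hδ]; linarith
  rw [min_eq_left this]; simp

lemma radialCutoff_of_mem {R δ : ℝ} (hδ : 0 < δ) {x : E3} (h1 : R - δ ≤ ‖x‖) (h2 : ‖x‖ ≤ R) :
    radialCutoff R δ x = δ⁻¹ * (R - ‖x‖) := by
  unfold radialCutoff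
  have : δ⁻¹ * (R - ‖x‖) ≤ 1 := by
    rw [inv_mul_eq_div, div_le_iff₀ hδ]; linarith
  rw [min_eq_right this]
  exact max_eq_right (mul_nonneg (by positivity) (by linarith))

lemma radialCutoff_nonneg (R δ : ℝ) (x : E3) : 0 ≤ radialCutoff R δ x := le_max_left _ _

lemma radialCutoff_le_one (R δ : ℝ) (x : E3) : radialCutoff R δ x ≤ 1 :=
  max_le zero_le_one (min_le_left _ _)

lemma hasCompactSupport_radialCutoff {R δ : ℝ} (hδ : 0 < δ) :
    HasCompactSupport (radialCutoff R δ) := by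
  refine HasCompactSupport.intro (isCompact_closedBall (0 : E3) R) fun x hx => ?_
  refine radialCutoff_of_ge hδ ?_
  simp at hx
  exact hx.le

lemma hasFDerivAt_norm_E3 {x : E3} (hx : x ≠ 0) :
    HasFDerivAt (fun y : E3 => ‖y‖) (‖x‖⁻¹ • innerSL ℝ x) x := by
  have h := (hasStrictFDerivAt_norm_sq x).hasFDerivAt.sqrt (by simpa using hx)
  have h2 : (fun y : E3 => √(‖y‖ ^ 2)) = fun y => ‖y‖ := by
    ext y; simp
  rw [h2] at h
  refine h.congr_fderiv ?_
  ext v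
  have : ‖x‖ ≠ 0 := by simpa using hx
  simp
  field_simp

/-- The cutoff is smooth off the two spheres where its formula changes, and spheres are null sets.
The direction is `-v` because Lipschitz integration by parts produces the derivative in that form.
-/
lemma ae_lineDeriv_radialCutoff {R δ : ℝ} (hδ : 0 < δ) (hδR : δ < R) (v : E3) :
    ∀ᵐ x : E3, lineDeriv ℝ (radialCutoff R δ) x (-v)
      = {x : E3 | R - δ < ‖x‖ ∧ ‖x‖ ≤ R}.indicator
        (fun x => δ⁻¹ * (‖x‖⁻¹ * inner ℝ x v)) x := by
  have h1 : ∀ᵐ x : E3, x ∉ sphere (0 : E3) R :=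
    measure_eq_zero_iff_ae_notMem.1 (Measure.addHaar_sphere _ _ _)
  have h2 : ∀ᵐ x : E3, x ∉ sphere (0 : E3) (R - δ) :=
    measure_eq_zero_iff_ae_notMem.1 (Measure.addHaar_sphere _ _ _)
  filter_upwards [h1, h2] with x hx1 hx2
  have hx1 : ‖x‖ ≠ R := by simpa using hx1
  have hx2 : ‖x‖ ≠ R - δ := by simpa using hx2
  rcases lt_or_gt_of_ne hx1 with hR | hR
  · rcases lt_or_gt_of_ne hx2 with hRδ | hRδ
    · have he : radialCutoff R δ =ᶠ[𝓝 x] fun _ => 1 := by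
        filter_upwards [continuous_norm.continuousAt.eventually_lt continuousAt_const hRδ] with y hy
        exact radialCutoff_of_le hδ hy.le
      have := ((hasFDerivAt_const (𝕜 := ℝ) (1 : ℝ) x).congr_of_eventuallyEq he).hasLineDerivAt (-v)
      rw [this.lineDeriv]
      simp [Set.indicator, not_lt.2 hRδ.le]
    · have hx0 : x ≠ 0 := by
        rintro rfl
        simp at hRδ
        linarith
      have he : radialCutoff R δ =ᶠ[𝓝 x] fun y => δ⁻¹ * (R - ‖y‖) := by
        filter_upwards [continuous_norm.continuousAt.eventually_lt continuousAt_const hR,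
          continuousAt_const.eventually_lt continuous_norm.continuousAt hRδ] with y hy hy'
        exact radialCutoff_of_mem hδ hy'.le hy.le
      have := ((((hasFDerivAt_norm_E3 hx0).const_sub R).const_mul
        δ⁻¹).congr_of_eventuallyEq he).hasLineDerivAt (-v)
      rw [this.lineDeriv]
      simp [Set.indicator, hRδ, hR.le]
  · have he : radialCutoff R δ =ᶠ[𝓝 x] fun _ => 0 := by
      filter_upwards [continuousAt_const.eventually_lt continuous_norm.continuousAt hR] with y hy
      exact radialCutoff_of_ge hδ hy.le
    have := ((hasFDerivAt_const (𝕜 := ℝ) (0 : ℝ) x).congr_of_eventuallyEq he).hasLineDerivAt (-v)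
    rw [this.lineDeriv]
    simp [Set.indicator, not_le.2 hR]

lemma inner_e (x : E3) (i : Fin 3) : inner ℝ x (e i) = x i := by
  simp [e, EuclideanSpace.inner_single_right]

lemma sum_inner_e_mul (x w : E3) : ∑ i, inner ℝ x (e i) * w i = inner ℝ w x := by
  simp only [inner_e]
  simp [PiLp.inner_apply]

lemma continuous_divOf : Continuous divOf := by
  unfold divOf
  fun_prop

/-- Integration by parts against the Lipschitz cutoff, one coordinate at a time: its gradient is
`-δ⁻¹ x/|x|` on the shell and zero elsewhere, up to null sets. -/
lemma integral_radialCutoff_mul_div {G : E3 → E3} (hG : ContDiff ℝ 1 G)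
    (hGc : HasCompactSupport G) {R δ : ℝ} (hδ : 0 < δ) (hδR : δ < R) :
    ∫ x, divOf (fderiv ℝ G x) * radialCutoff R δ x
      = ∫ x in {x : E3 | R - δ < ‖x‖ ∧ ‖x‖ ≤ R}, δ⁻¹ * (‖x‖⁻¹ * inner ℝ (G x) x) := by
  have hm : MeasurableSet {x : E3 | R - δ < ‖x‖ ∧ ‖x‖ ≤ R} :=
    (measurableSet_lt measurable_const measurable_norm).inter
      (measurableSet_le measurable_norm measurable_const)
  have hGi : ∀ i : Fin 3, ContDiff ℝ 1 fun x => G x i := fun i => by fun_prop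
  have hGci : ∀ i : Fin 3, HasCompactSupport fun x => G x i := fun i =>
    hGc.comp_left (g := fun w : E3 => w i) rfl
  have hd : ∀ x i, fderiv ℝ G x (e i) i = lineDeriv ℝ (fun x => G x i) x (e i) := fun x i => by
    have h := (hG.differentiable one_ne_zero x).hasFDerivAt
    have h2 : HasFDerivAt (fun x => G x i)
        ((EuclideanSpace.proj i : E3 →L[ℝ] ℝ).comp (fderiv ℝ G x)) x :=
      (EuclideanSpace.proj i : E3 →L[ℝ] ℝ).hasFDerivAt.comp x h
    rw [(h2.hasLineDerivAt (e i)).lineDeriv]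
    rfl
  have hcd : ∀ i, Continuous fun x => fderiv ℝ G x (e i) i := fun i => by
    have := hG.continuous_fderiv one_ne_zero
    fun_prop
  have hη := lipschitzWith_radialCutoff R δ
  have hηc := hasCompactSupport_radialCutoff (R := R) hδ
  have hI : ∀ i, Integrable fun x => fderiv ℝ G x (e i) i * radialCutoff R δ x := fun i =>
    ((hcd i).mul hη.continuous).integrable_of_hasCompactSupport hηc.mul_left
  have hsum : ∀ x, divOf (fderiv ℝ G x) * radialCutoff R δ x
      = ∑ i, fderiv ℝ G x (e i) i * radialCutoff R δ x := fun x => by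
    rw [divOf, Finset.sum_mul]
  simp_rw [hsum]
  rw [integral_finsetSum _ fun i _ => hI i]
  have hpart : ∀ i, ∫ x, fderiv ℝ G x (e i) i * radialCutoff R δ x
      = ∫ x, lineDeriv ℝ (radialCutoff R δ) x (-(e i)) * G x i := fun i => by
    simp_rw [hd]
    obtain ⟨C, hC⟩ := (hGi i).lipschitzWith_of_hasCompactSupport (hGci i) one_ne_zero
    exact LipschitzWith.integral_lineDeriv_mul_eq hC hη hηc (e i)
  have hI2 : ∀ i, Integrable fun x => lineDeriv ℝ (radialCutoff R δ) x (-(e i)) * G x i :=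
    fun i => by
      refine Integrable.bdd_mul (c := Real.nnabs δ⁻¹ * ‖-(e i)‖)
        (((hGi i).continuous).integrable_of_hasCompactSupport (hGci i)) ?_ ?_
      · exact (aestronglyMeasurable_lineDeriv hη.continuous _)
      · exact Eventually.of_forall fun x => norm_lineDeriv_le_of_lipschitz ℝ hη
  simp_rw [hpart]
  rw [← integral_finsetSum _ fun i _ => hI2 i, ← integral_indicator hm]
  refine integral_congr_ae ?_
  filter_upwards [ae_all_iff.2 fun i => ae_lineDeriv_radialCutoff hδ hδR (e i)] with x hx
  simp_rw [hx]
  by_cases hA : x ∈ {x : E3 | R - δ < ‖x‖ ∧ ‖x‖ ≤ R}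
  · simp only [Set.indicator_of_mem hA]
    rw [← sum_inner_e_mul x (G x), Finset.mul_sum, Finset.mul_sum]
    refine Finset.sum_congr rfl fun i _ => ?_
    ring
  · simp only [Set.indicator_of_notMem hA]
    simp

lemma tendsto_left_average {Ψ : ℝ → ℝ} (hΨ : Continuous Ψ) (R : ℝ) :
    Tendsto (fun δ => δ⁻¹ * ∫ r in (R - δ)..R, Ψ r) (𝓝[>] 0) (𝓝 (Ψ R)) := by
  have h : HasDerivAt (fun s => ∫ r in R..s, Ψ r) (Ψ R) R :=
    intervalIntegral.integral_hasDerivAt_right (hΨ.intervalIntegrable _ _)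
      (hΨ.stronglyMeasurableAtFilter _ _) hΨ.continuousAt
  have h2 := hasDerivAt_iff_tendsto_slope_zero.1 h
  have h3 : Tendsto (fun δ : ℝ => -δ) (𝓝[>] 0) (𝓝[≠] 0) := by
    refine tendsto_nhdsWithin_iff.2 ⟨?_, ?_⟩
    · have : Tendsto (fun δ : ℝ => -δ) (𝓝 0) (𝓝 (-0)) := continuous_neg.tendsto 0
      rw [neg_zero] at this
      exact this.mono_left nhdsWithin_le_nhds
    · filter_upwards [self_mem_nhdsWithin] with δ hδ
      have : (0 : ℝ) < δ := hδ
      simpa using this.ne'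
  refine (h2.comp h3).congr fun δ => ?_
  simp only [Function.comp_apply, intervalIntegral.integral_same, sub_zero, smul_eq_mul]
  rw [intervalIntegral.integral_symm, inv_neg, neg_mul_neg, ← sub_eq_add_neg]

lemma tendsto_integral_mul_radialCutoff {f : E3 → ℝ} (hf : Integrable f) {R : ℝ} :
    Tendsto (fun δ => ∫ x, f x * radialCutoff R δ x) (𝓝[>] 0) (𝓝 (∫ x in ball 0 R, f x)) := by
  rw [← integral_indicator measurableSet_ball]
  refine tendsto_integral_filter_of_dominated_convergence (fun x => ‖f x‖) ?_ ?_ hf.norm ?_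
  · exact Eventually.of_forall fun δ =>
      hf.aestronglyMeasurable.mul (lipschitzWith_radialCutoff R δ).continuous.aestronglyMeasurable
  · refine Eventually.of_forall fun δ => Eventually.of_forall fun x => ?_
    rw [norm_mul]
    refine mul_le_of_le_one_right (norm_nonneg _) ?_
    rw [Real.norm_of_nonneg (radialCutoff_nonneg _ _ _)]
    exact radialCutoff_le_one _ _ _
  · have h1 : ∀ᵐ x : E3, x ∉ sphere (0 : E3) R :=
      measure_eq_zero_iff_ae_notMem.1 (Measure.addHaar_sphere _ _ _)
    filter_upwards [h1] with x hx
    have hx : ‖x‖ ≠ R := by simpa using hx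
    rcases lt_or_gt_of_ne hx with hR | hR
    · have hmem : x ∈ ball (0 : E3) R := by simpa using hR
      rw [Set.indicator_of_mem hmem]
      refine tendsto_const_nhds.congr' ?_
      have : Set.Ioo (0 : ℝ) (R - ‖x‖) ∈ 𝓝[>] (0 : ℝ) :=
        Ioo_mem_nhdsGT (by linarith)
      filter_upwards [this] with δ hδ
      rw [radialCutoff_of_le hδ.1 (by linarith [hδ.2]), mul_one]
    · have hmem : x ∉ ball (0 : E3) R := by simpa using hR.le
      rw [Set.indicator_of_notMem hmem]
      refine tendsto_const_nhds.congr' ?_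
      filter_upwards [self_mem_nhdsWithin] with δ hδ
      rw [radialCutoff_of_ge hδ hR.le, mul_zero]

/-- As `δ → 0` the cutoff tends to the indicator of the ball, while the shell integral is a left
average of the spherical integrals and tends to the one over the sphere of radius `R`. -/
lemma integral_div_ball_of_hasCompactSupport {G : E3 → E3} (hG : ContDiff ℝ 1 G)
    (hGc : HasCompactSupport G) {R : ℝ} (hR : 0 < R) :
    R * ∫ x in ball 0 R, divOf (fderiv ℝ G x) = ∫ x, inner ℝ (G x) x ∂(surfaceMeasure R) := by
  have hdc : Continuous fun x => divOf (fderiv ℝ G x) :=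
    continuous_divOf.comp (hG.continuous_fderiv one_ne_zero)
  have hdi : Integrable fun x => divOf (fderiv ℝ G x) := by
    refine hdc.integrable_of_hasCompactSupport ?_
    exact (hGc.fderiv (𝕜 := ℝ)).comp_left (g := divOf) (by simp [divOf])
  have hL := tendsto_integral_mul_radialCutoff hdi (R := R)
  -- The maximum with `R / 2` makes the normal component continuous at the origin and changes
  -- nothing on the shells with `δ < R / 2`.
  set h : E3 → ℝ := fun x => (max (R / 2) ‖x‖)⁻¹ * inner ℝ (G x) x with hh
  have hpos : ∀ x : E3, 0 < max (R / 2) ‖x‖ := fun x => lt_max_of_lt_left (by linarith)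
  have hhc : Continuous h := by
    have := hG.continuous
    refine Continuous.mul (Continuous.inv₀ (by fun_prop) fun x => (hpos x).ne') (by fun_prop)
  have hRt := tendsto_left_average (continuous_sphere_average hhc) R
  have heq : ∀ᶠ δ in 𝓝[>] (0 : ℝ), ∫ x, divOf (fderiv ℝ G x) * radialCutoff R δ x
      = δ⁻¹ * ∫ r in (R - δ)..R, r ^ 2 * ∫ y, h (r • (y : E3)) ∂sphereMeasure := by
    have : Set.Ioo (0 : ℝ) (R / 2) ∈ 𝓝[>] (0 : ℝ) := Ioo_mem_nhdsGT (by linarith)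
    filter_upwards [this] with δ hδ
    rw [integral_radialCutoff_mul_div hG hGc hδ.1 (by linarith [hδ.2]),
      ← integral_annulus hhc (by linarith [hδ.2]) (by linarith [hδ.1]), integral_const_mul]
    congr 1
    refine setIntegral_congr_fun ?_ fun x hx => ?_
    · exact (measurableSet_lt measurable_const measurable_norm).inter
        (measurableSet_le measurable_norm measurable_const)
    · have : R / 2 ≤ ‖x‖ := by linarith [hx.1, hδ.2]
      simp only [hh, max_eq_right this]
  have hfin := tendsto_nhds_unique (hL.congr' heq) hRt
  rw [hfin, integral_surfaceMeasure hR, smul_eq_mul]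
  have : ∀ y : sphere (0 : E3) 1, h (R • (y : E3))
      = R⁻¹ * inner ℝ (G (R • (y : E3))) (R • (y : E3)) := fun y => by
    have hn : ‖R • (y : E3)‖ = R := by simp [norm_smul, abs_of_pos hR]
    simp only [hh, hn]
    rw [max_eq_right (by linarith)]
  simp_rw [this]
  rw [integral_const_mul]
  field_simp

/-- The **divergence theorem** on the ball of radius `R` about the origin. -/
theorem integral_div_ball {F : E3 → E3} (hF : ContDiff ℝ 1 F) {R : ℝ} (hR : 0 < R) :
    R * ∫ x in ball 0 R, divOf (fderiv ℝ F x) = ∫ x, inner ℝ (F x) x ∂(surfaceMeasure R) := by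
  -- The bump is `1` on a neighbourhood of the closed ball, so neither the divergence in the ball
  -- nor the values on the sphere change.
  let χ : ContDiffBump (0 : E3) := ⟨R + 1, R + 2, by linarith, by linarith⟩
  have hχ : ∀ x ∈ ball (0 : E3) (R + 1), χ x = 1 := fun x hx =>
    χ.one_of_mem_closedBall (ball_subset_closedBall hx)
  have hG : ContDiff ℝ 1 fun x => χ x • F x := χ.contDiff.smul hF
  have hGc : HasCompactSupport fun x => χ x • F x := χ.hasCompactSupport.smul_right
  have h := integral_div_ball_of_hasCompactSupport hG hGc hR
  have hloc : ∀ x ∈ ball (0 : E3) (R + 1), (fun x => χ x • F x) =ᶠ[𝓝 x] F := fun x hx => by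
    filter_upwards [isOpen_ball.mem_nhds hx] with y hy
    rw [hχ y hy, one_smul]
  have h1 : ∫ x in ball 0 R, divOf (fderiv ℝ (fun x => χ x • F x) x)
      = ∫ x in ball 0 R, divOf (fderiv ℝ F x) :=
    setIntegral_congr_fun measurableSet_ball fun x hx => by
      have := (hloc x (ball_subset_ball (by linarith) hx)).fderiv_eq (𝕜 := ℝ)
      simp only [this]
  have h2 : ∫ x, inner ℝ (χ x • F x) x ∂(surfaceMeasure R)
      = ∫ x, inner ℝ (F x) x ∂(surfaceMeasure R) := by
    refine integral_congr_ae ?_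
    filter_upwards [ae_surfaceMeasure_norm_eq hR] with x hx
    rw [hχ x (by simp [hx]), one_smul]
  rw [← h1, h, h2]

/-! ### Mollification -/

section Mollify

variable {F : Type*} [NormedAddCommGroup F] [NormedSpace ℝ F]

/-- Convolution with a normalized smooth bump function. -/
def mollify (φ : ContDiffBump (0 : E3)) (f : E3 → F) : E3 → F :=
  convolution (φ.normed volume) f (ContinuousLinearMap.lsmul ℝ ℝ) volume

lemma mollify_apply (φ : ContDiffBump (0 : E3)) (f : E3 → F) (x : E3) :
    mollify φ f x = ∫ t, φ.normed volume t • f (x - t) := rfl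

lemma mollify_apply_swap (φ : ContDiffBump (0 : E3)) (f : E3 → F) (x : E3) :
    mollify φ f x = ∫ t, φ.normed volume (x - t) • f t := by
  rw [mollify, convolution_eq_swap]
  rfl

lemma convolutionExists_mollify (φ : ContDiffBump (0 : E3)) {f : E3 → F}
    (hf : LocallyIntegrable f) :
    ConvolutionExists (φ.normed volume) f (ContinuousLinearMap.lsmul ℝ ℝ) volume :=
  φ.hasCompactSupport_normed.convolutionExists_left _ φ.continuous_normed hf

lemma contDiff_mollify [CompleteSpace F] (φ : ContDiffBump (0 : E3)) {f : E3 → F}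
    (hf : LocallyIntegrable f) : ContDiff ℝ ∞ (mollify φ f) :=
  φ.hasCompactSupport_normed.contDiff_convolution_left _ φ.contDiff_normed hf

lemma hasCompactSupport_mollify (φ : ContDiffBump (0 : E3)) {f : E3 → F}
    (hf : HasCompactSupport f) : HasCompactSupport (mollify φ f) :=
  φ.hasCompactSupport_normed.convolution _ hf

lemma mollify_sub (φ : ContDiffBump (0 : E3)) {f g : E3 → F}
    (hf : LocallyIntegrable f) (hg : LocallyIntegrable g) :
    mollify φ (f - g) = mollify φ f - mollify φ g := by
  ext x
  simp only [mollify_apply, Pi.sub_apply, smul_sub]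
  exact integral_sub (convolutionExists_mollify φ hf x) (convolutionExists_mollify φ hg x)

lemma enorm_mollify_le (φ : ContDiffBump (0 : E3)) {f : E3 → F}
    (hf : AEStronglyMeasurable f volume) (x : E3) :
    ‖mollify φ f x‖ₑ
      ≤ ∫⁻ t, ‖f (x - t)‖ₑ ∂(volume.withDensity fun t => ENNReal.ofReal (φ.normed volume t)) := by
  have hfx : AEStronglyMeasurable (fun t => f (x - t)) volume :=
    hf.comp_measurePreserving (Measure.measurePreserving_sub_left volume x)
  rw [lintegral_withDensity_eq_lintegral_mul₀
    φ.continuous_normed.measurable.ennreal_ofReal.aemeasurable hfx.enorm, mollify_apply]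
  refine (enorm_integral_le_lintegral_enorm _).trans_eq ?_
  refine lintegral_congr fun t => ?_
  rw [enorm_smul, Pi.mul_apply, Real.enorm_of_nonneg (φ.nonneg_normed t)]

/-- The normalized bump is the density of a probability measure. Jensen's inequality, in the form of
monotonicity of the norms in the exponent, bounds the `p`-th power pointwise; Tonelli and
translation invariance finish. -/
lemma eLpNorm_mollify_le (φ : ContDiffBump (0 : E3)) {f : E3 → F}
    (hf : AEStronglyMeasurable f volume) {p : ℝ≥0∞} (hp : 1 ≤ p) (hp' : p ≠ ⊤) :
    eLpNorm (mollify φ f) p volume ≤ eLpNorm f p volume := by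
  have hp0 : p ≠ 0 := (zero_lt_one.trans_le hp).ne'
  have hq : 1 ≤ p.toReal := by
    rw [← ENNReal.toReal_one]; exact ENNReal.toReal_mono hp' hp
  have hq0 : 0 < p.toReal := by linarith
  set ν : Measure E3 := volume.withDensity fun t => ENNReal.ofReal (φ.normed volume t) with hν
  have hνp : IsProbabilityMeasure ν := by
    constructor
    rw [hν, withDensity_apply _ MeasurableSet.univ, Measure.restrict_univ,
      ← ofReal_integral_eq_lintegral_ofReal φ.integrable_normed
        (Eventually.of_forall fun t => φ.nonneg_normed t), φ.integral_normed, ENNReal.ofReal_one]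
  have hjensen : ∀ x, ‖mollify φ f x‖ₑ ^ p.toReal ≤ ∫⁻ t, ‖f (x - t)‖ₑ ^ p.toReal ∂ν := by
    intro x
    have hfx : AEStronglyMeasurable (fun t => f (x - t)) ν :=
      (hf.comp_measurePreserving (Measure.measurePreserving_sub_left volume x)).mono_ac
        (withDensity_absolutelyContinuous _ _)
    have h := eLpNorm'_le_eLpNorm'_of_exponent_le zero_lt_one hq ν hfx
    simp only [eLpNorm', ENNReal.rpow_one, div_one] at h
    calc ‖mollify φ f x‖ₑ ^ p.toReal
        ≤ ((∫⁻ t, ‖f (x - t)‖ₑ ^ p.toReal ∂ν) ^ (1 / p.toReal)) ^ p.toReal :=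
          ENNReal.rpow_le_rpow ((enorm_mollify_le φ hf x).trans h) hq0.le
      _ = _ := by
          rw [← ENNReal.rpow_mul, one_div, inv_mul_cancel₀ hq0.ne', ENNReal.rpow_one]
  rw [eLpNorm_eq_eLpNorm' hp0 hp', eLpNorm_eq_eLpNorm' hp0 hp', eLpNorm', eLpNorm']
  refine ENNReal.rpow_le_rpow ?_ (by positivity)
  calc ∫⁻ x, ‖mollify φ f x‖ₑ ^ p.toReal
      ≤ ∫⁻ x, ∫⁻ t, ‖f (x - t)‖ₑ ^ p.toReal ∂ν := lintegral_mono hjensen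
    _ = ∫⁻ t, ∫⁻ x, ‖f (x - t)‖ₑ ^ p.toReal ∂volume ∂ν := by
        refine lintegral_lintegral_swap ?_
        have := (hf.comp_quasiMeasurePreserving
          (quasiMeasurePreserving_sub_of_right_invariant volume ν)).enorm.pow_const p.toReal
        exact this
    _ = ∫⁻ _, ∫⁻ x, ‖f x‖ₑ ^ p.toReal ∂volume ∂ν :=
        lintegral_congr fun t => lintegral_sub_right_eq_self (fun x => ‖f x‖ₑ ^ p.toReal) t
    _ = ∫⁻ x, ‖f x‖ₑ ^ p.toReal := by simp

/-- Bump functions shrinking to the origin. -/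
def shrinkingBump (n : ℕ) : ContDiffBump (0 : E3) :=
  ⟨1 / (2 * ((n : ℝ) + 1)), 1 / ((n : ℝ) + 1), by positivity, by
    have : (0 : ℝ) < n + 1 := by positivity
    exact one_div_lt_one_div_of_lt this (by linarith)⟩

lemma tendsto_shrinkingBump_rOut : Tendsto (fun n => (shrinkingBump n).rOut) atTop (𝓝 0) :=
  tendsto_one_div_add_atTop_nhds_zero_nat

lemma shrinkingBump_rOut_le_one (n : ℕ) : (shrinkingBump n).rOut ≤ 1 := by
  have : (1 : ℝ) ≤ n + 1 := by simp
  exact (div_le_one (by positivity)).2 this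

lemma support_mollify_subset (φ : ContDiffBump (0 : E3)) (hφ : φ.rOut ≤ 1) (g : E3 → F) :
    Function.support (mollify φ g) ⊆ cthickening 1 (tsupport g) := by
  intro x hx
  by_contra hx'
  refine hx ?_
  rw [mollify_apply]
  refine integral_eq_zero_of_ae (Eventually.of_forall fun t => ?_)
  simp only [Pi.zero_apply, smul_eq_zero]
  by_contra! h
  have ht : t ∈ ball (0 : E3) φ.rOut := by
    rw [← φ.support_normed_eq (μ := volume)]; exact h.1
  have hxt : x - t ∈ tsupport g := subset_tsupport g h.2
  refine hx' (mem_cthickening_of_dist_le x (x - t) 1 _ hxt ?_)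
  have : ‖t‖ < φ.rOut := by simpa using ht
  simp only [dist_eq_norm, sub_sub_cancel]
  linarith

/-- Uniform continuity makes the difference uniformly small, and all mollifications are supported in
one compact set, the closed 1-neighbourhood of the support. -/
lemma tendsto_mollify_of_continuous [CompleteSpace F] {g : E3 → F} (hg : Continuous g)
    (hgc : HasCompactSupport g) {p : ℝ≥0∞} (hp' : p ≠ ⊤) :
    Tendsto (fun n => eLpNorm (mollify (shrinkingBump n) g - g) p volume) atTop (𝓝 0) := by
  set K := cthickening 1 (tsupport g) with hK
  have hKm : MeasurableSet K := isClosed_cthickening.measurableSet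
  have hKf : volume K ≠ ⊤ := hgc.isCompact.cthickening.measure_ne_top
  have huc : UniformContinuous g := hg.uniformContinuous_of_tendsto_cocompact
    (hgc.is_zero_at_infty)
  have hbound : ∀ c : ℝ, 0 < c → ∀ᶠ n in atTop,
      eLpNorm (mollify (shrinkingBump n) g - g) p volume
        ≤ ENNReal.ofReal c * volume K ^ (1 / p.toReal) := by
    intro c hc
    obtain ⟨d, hd, hdc⟩ := Metric.uniformContinuous_iff.1 huc c hc
    filter_upwards [tendsto_shrinkingBump_rOut.eventually (gt_mem_nhds hd)] with n hn
    refine eLpNorm_sub_le_of_dist_bdd volume hp' hKm hc.le (fun x => ?_) ?_ ?_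
    · refine ContDiffBump.dist_normed_convolution_le hg.aestronglyMeasurable fun y hy => ?_
      exact (hdc ((mem_ball.1 hy).trans hn)).le
    · exact support_mollify_subset _ (shrinkingBump_rOut_le_one n) g
    · exact (subset_tsupport g).trans (self_subset_cthickening _)
  rw [ENNReal.tendsto_nhds_zero]
  intro ε hε
  have hV : volume K ^ (1 / p.toReal) ≠ ⊤ := ENNReal.rpow_ne_top_of_nonneg (by positivity) hKf
  have hlim : Tendsto (fun c : ℝ => ENNReal.ofReal c * volume K ^ (1 / p.toReal)) (𝓝[>] 0)
      (𝓝 0) := by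
    have h1 : Tendsto (fun c : ℝ => ENNReal.ofReal c) (𝓝[>] 0) (𝓝 0) := by
      have := (ENNReal.continuous_ofReal.tendsto 0).mono_left
        (nhdsWithin_le_nhds (s := Set.Ioi (0 : ℝ)))
      simpa using this
    simpa using ENNReal.Tendsto.mul_const h1 (Or.inr hV)
  obtain ⟨c, hc1, hc2⟩ := ((ENNReal.tendsto_nhds_zero.1 hlim ε hε).and self_mem_nhdsWithin).exists
  filter_upwards [hbound c hc2] with n hn using hn.trans hc1

/-- Continuous functions of compact support are dense in `L^p`, and mollification does not increase
the norm, so the error splits into three thirds. -/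
theorem tendsto_eLpNorm_mollify_sub [CompleteSpace F] {f : E3 → F} {p : ℝ≥0∞} (hp : 1 ≤ p)
    (hp' : p ≠ ⊤) (hf : MemLp f p volume) :
    Tendsto (fun n => eLpNorm (mollify (shrinkingBump n) f - f) p volume) atTop (𝓝 0) := by
  have hfl : LocallyIntegrable f := hf.locallyIntegrable hp
  rw [ENNReal.tendsto_nhds_zero]
  intro ε hε
  have hε3 : ε / 3 ≠ 0 := (ENNReal.div_pos hε.ne' (by simp)).ne'
  obtain ⟨g, hgc, hfg, hg, hgp⟩ := hf.exists_hasCompactSupport_eLpNorm_sub_le hp' hε3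
  have hgl : LocallyIntegrable g := hgp.locallyIntegrable hp
  have hev := ENNReal.tendsto_nhds_zero.1 (tendsto_mollify_of_continuous hg hgc hp') (ε / 3)
    (pos_iff_ne_zero.2 hε3)
  filter_upwards [hev] with n hn
  set φ := shrinkingBump n
  have hmf : AEStronglyMeasurable (mollify φ f) volume :=
    (contDiff_mollify φ hfl).continuous.aestronglyMeasurable
  have hmg : AEStronglyMeasurable (mollify φ g) volume :=
    (contDiff_mollify φ hgl).continuous.aestronglyMeasurable
  have hdec : mollify φ f - f = mollify φ (f - g) + ((mollify φ g - g) - (f - g)) := by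
    rw [mollify_sub φ hfl hgl]; abel
  have hfgm : AEStronglyMeasurable (f - g) volume := hf.1.sub hgp.1
  rw [hdec]
  calc eLpNorm (mollify φ (f - g) + ((mollify φ g - g) - (f - g))) p volume
      ≤ eLpNorm (mollify φ (f - g)) p volume
        + eLpNorm ((mollify φ g - g) - (f - g)) p volume :=
        eLpNorm_add_le (by rw [mollify_sub φ hfl hgl]; exact hmf.sub hmg)
          ((hmg.sub hgp.1).sub hfgm) hp
    _ ≤ eLpNorm (f - g) p volume
        + (eLpNorm (mollify φ g - g) p volume + eLpNorm (f - g) p volume) := by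
        gcongr
        · exact eLpNorm_mollify_le φ hfgm hp hp'
        · exact eLpNorm_sub_le (hmg.sub hgp.1) hfgm hp
    _ ≤ ε / 3 + (ε / 3 + ε / 3) := by gcongr
    _ = ε := by rw [← add_assoc, ENNReal.add_thirds]

end Mollify

/-- Mollification commutes with the weak derivative. -/
lemma fderiv_mollify {u : E3 → E3} {G : E3 → (E3 →L[ℝ] E3)} (h : HasWeakDeriv u G)
    (φ : ContDiffBump (0 : E3)) (x : E3) : fderiv ℝ (mollify φ u) x = mollify φ G x := by
  have hφ : ContDiff ℝ ∞ (φ.normed (volume : Measure E3)) := φ.contDiff_normed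
  have hφ1 : ContDiff ℝ 1 (φ.normed (volume : Measure E3)) := φ.contDiff_normed
  have hφc : HasCompactSupport (φ.normed (volume : Measure E3)) := φ.hasCompactSupport_normed
  have hd := (hφc.hasFDerivAt_convolution_left (ContinuousLinearMap.lsmul ℝ ℝ) hφ1
    h.locallyIntegrable x).fderiv
  have hex : ConvolutionExistsAt (fderiv ℝ (φ.normed volume)) u x
      (ContinuousLinearMap.precompL E3 (ContinuousLinearMap.lsmul ℝ ℝ)) volume :=
    (hφc.fderiv (𝕜 := ℝ)).convolutionExists_left _ (hφ1.continuous_fderiv one_ne_zero)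
      h.locallyIntegrable x
  rw [mollify, hd]
  ext1 v
  have hmx : mollify φ G x v = ∫ t, φ.normed volume (x - t) • G t v := by
    rw [mollify_apply_swap, ContinuousLinearMap.integral_apply]
    · rfl
    · exact (convolutionExists_mollify φ h.locallyIntegrable_deriv x).integrable_swap
  rw [hmx, convolution_eq_swap, ContinuousLinearMap.integral_apply hex.integrable_swap]
  -- The weak derivative is tested with the reflected bump `t ↦ φ (x - t)`; the sign from the
  -- reflection cancels the one in the definition.
  have hψ : ContDiff ℝ ∞ fun t => φ.normed (volume : Measure E3) (x - t) :=
    hφ.comp (contDiff_const.sub contDiff_id)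
  have hψc : HasCompactSupport fun t => φ.normed (volume : Measure E3) (x - t) :=
    hφc.comp_homeomorph (Homeomorph.subLeft x)
  have hw := h.integral_eq _ hψ hψc v
  have hψd : ∀ t, fderiv ℝ (fun t => φ.normed (volume : Measure E3) (x - t)) t v
      = -fderiv ℝ (φ.normed volume) (x - t) v := fun t => by
    have h1 := ((hφ1.differentiable one_ne_zero (x - t)).hasFDerivAt).comp t
      ((hasFDerivAt_id (𝕜 := ℝ) t).const_sub x)
    have h2 : fderiv ℝ (fun t => φ.normed (volume : Measure E3) (x - t)) t = _ := h1.fderiv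
    rw [h2]
    simp
  simp_rw [hψd, neg_smul] at hw
  rw [integral_neg, neg_inj] at hw
  exact hw

/-! ### Limits in `L^p` -/

section Limits

variable {X : Type*} [MeasurableSpace X] {μ : Measure X} {F : Type*} [NormedAddCommGroup F]

lemma tendsto_eLpNorm_sub_sub {f : ℕ → X → F} {g : X → F} {p : ℝ≥0∞} (hp : 1 ≤ p)
    (hf : ∀ n, AEStronglyMeasurable (f n) μ) (hg : AEStronglyMeasurable g μ)
    (h : Tendsto (fun n => eLpNorm (f n - g) p μ) atTop (𝓝 0)) :
    Tendsto (fun n : ℕ × ℕ => eLpNorm (f n.1 - f n.2) p μ) atTop (𝓝 0) := by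
  rw [← prod_atTop_atTop_eq]
  have h2 := (h.comp (tendsto_fst (f := atTop) (g := (atTop : Filter ℕ)))).add
    (h.comp (tendsto_snd (f := (atTop : Filter ℕ)) (g := atTop)))
  rw [add_zero] at h2
  refine tendsto_of_tendsto_of_tendsto_of_le_of_le tendsto_const_nhds h2 (fun _ => zero_le) ?_
  intro n
  have : f n.1 - f n.2 = (f n.1 - g) - (f n.2 - g) := by abel
  simp only [this, Function.comp_apply]
  exact eLpNorm_sub_le ((hf _).sub hg) ((hf _).sub hg) hp

lemma exists_memLp_tendsto [CompleteSpace F] {f : ℕ → X → F} {p : ℝ≥0∞} (hp : 1 ≤ p)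
    (hf : ∀ n, MemLp (f n) p μ)
    (h : Tendsto (fun n : ℕ × ℕ => eLpNorm (f n.1 - f n.2) p μ) atTop (𝓝 0)) :
    ∃ g, MemLp g p μ ∧ Tendsto (fun n => eLpNorm (f n - g) p μ) atTop (𝓝 0) := by
  have : Fact (1 ≤ p) := ⟨hp⟩
  have hc : CauchySeq fun n => (hf n).toLp (f n) := by
    rw [Lp.cauchySeq_Lp_iff_cauchySeq_eLpNorm]
    refine h.congr fun n => ?_
    exact eLpNorm_congr_ae ((hf n.1).coeFn_toLp.symm.sub (hf n.2).coeFn_toLp.symm)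
  obtain ⟨g, hg⟩ := cauchySeq_tendsto_of_complete hc
  refine ⟨g, Lp.memLp g, ?_⟩
  have := (Lp.tendsto_Lp_iff_tendsto_eLpNorm' _ _).1 hg
  refine this.congr fun n => ?_
  exact eLpNorm_congr_ae ((hf n).coeFn_toLp.sub (ae_eq_refl _))

/-- Both convergences imply convergence in measure, whose limit is unique. The two exponents may
differ; this identifies `L³` limits with `L^{3/2}` limits. -/
lemma ae_eq_of_tendsto_eLpNorm {f : ℕ → X → F} {g h : X → F} {p q : ℝ≥0∞} (hp : p ≠ 0)
    (hq : q ≠ 0) (hf : ∀ n, AEStronglyMeasurable (f n) μ) (hg : AEStronglyMeasurable g μ)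
    (hh : AEStronglyMeasurable h μ)
    (hfg : Tendsto (fun n => eLpNorm (f n - g) p μ) atTop (𝓝 0))
    (hfh : Tendsto (fun n => eLpNorm (f n - h) q μ) atTop (𝓝 0)) : g =ᵐ[μ] h :=
  tendstoInMeasure_ae_unique (tendstoInMeasure_of_tendsto_eLpNorm hp hf hg hfg)
    (tendstoInMeasure_of_tendsto_eLpNorm hq hf hh hfh)

lemma tendsto_eLpNorm_of_le {f g : ℕ → ℝ≥0∞} (h : ∀ n, f n ≤ g n) (hg : Tendsto g atTop (𝓝 0)) :
    Tendsto f atTop (𝓝 0) :=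
  tendsto_of_tendsto_of_tendsto_of_le_of_le tendsto_const_nhds hg (fun _ => zero_le) h

end Limits

/-! ### Approximation by smooth fields -/

/-- The product rule follows on testing the weak derivative of `u` with `φ χ`. -/
lemma HasWeakDeriv.smul {u : E3 → E3} {G : E3 → (E3 →L[ℝ] E3)} (h : HasWeakDeriv u G)
    {χ : E3 → ℝ} (hχ : ContDiff ℝ ∞ χ) :
    HasWeakDeriv (fun x => χ x • u x)
      (fun x => χ x • G x + (fderiv ℝ χ x).smulRight (u x)) := by
  have hχ1 : Differentiable ℝ χ := hχ.differentiable (by simp)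
  have hχd : Continuous (fderiv ℝ χ) := hχ.continuous_fderiv (by simp)
  have hL2 : LocallyIntegrable fun x => (fderiv ℝ χ x).smulRight (u x) := by
    have hm : AEStronglyMeasurable (fun x => (fderiv ℝ χ x).smulRight (u x)) volume :=
      ((ContinuousLinearMap.smulRightL ℝ E3 E3).continuous₂.comp_aestronglyMeasurable
        (hχd.aestronglyMeasurable.prodMk h.locallyIntegrable.aestronglyMeasurable))
    have hn : LocallyIntegrable fun x => ‖u x‖ := fun x => (h.locallyIntegrable x).norm
    have hi := hn.continuous_smul hχd.norm
    refine hi.mono hm (Eventually.of_forall fun x => ?_)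
    rw [ContinuousLinearMap.norm_smulRight_apply, norm_smul, norm_norm, norm_norm]
  refine ⟨h.locallyIntegrable.continuous_smul hχ.continuous,
    (h.locallyIntegrable_deriv.continuous_smul hχ.continuous).add hL2, fun φ hφ hφc v => ?_⟩
  have hφ1 : Differentiable ℝ φ := hφ.differentiable (by simp)
  have hφd : Continuous (fderiv ℝ φ) := hφ.continuous_fderiv (by simp)
  have hw := h.integral_eq (fun x => φ x * χ x) (hφ.mul hχ) hφc.mul_right v
  have hd : ∀ x, fderiv ℝ (fun x => φ x * χ x) x v
      = φ x * fderiv ℝ χ x v + χ x * fderiv ℝ φ x v := fun x => by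
    rw [fderiv_fun_mul (hφ1 x) (hχ1 x)]
    simp
  have i1 : Integrable fun x => (φ x * fderiv ℝ χ x v) • u x :=
    h.locallyIntegrable.integrable_smul_left_of_hasCompactSupport
      (hφ.continuous.mul (hχd.clm_apply continuous_const)) hφc.mul_right
  have i2 : Integrable fun x => (χ x * fderiv ℝ φ x v) • u x :=
    h.locallyIntegrable.integrable_smul_left_of_hasCompactSupport
      (hχ.continuous.mul (hφd.clm_apply continuous_const))
      ((hφc.fderiv_apply (𝕜 := ℝ) v).mul_left)
  have i3 : Integrable fun x => (φ x * χ x) • G x v := by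
    have := h.locallyIntegrable_deriv.integrable_smul_left_of_hasCompactSupport
      (hφ.continuous.mul hχ.continuous) hφc.mul_right
    exact this.apply_continuousLinearMap v
  simp_rw [hd, add_smul] at hw
  rw [integral_add i1 i2] at hw
  have e1 : ∫ x, fderiv ℝ φ x v • χ x • u x = ∫ x, (χ x * fderiv ℝ φ x v) • u x := by
    refine integral_congr_ae (Eventually.of_forall fun x => ?_)
    simp only [smul_smul, mul_comm]
  have e2 : ∫ x, φ x • (χ x • G x + (fderiv ℝ χ x).smulRight (u x)) v
      = (∫ x, (φ x * χ x) • G x v) + ∫ x, (φ x * fderiv ℝ χ x v) • u x := by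
    rw [← integral_add i3 i1]
    refine integral_congr_ae (Eventually.of_forall fun x => ?_)
    simp [smul_smul]
  rw [e1, e2, neg_add, ← hw]
  abel

lemma MemLpLoc.memLp_of_hasCompactSupport {F F' : Type*} [NormedAddCommGroup F]
    [NormedAddCommGroup F'] {f : E3 → F} {g : E3 → F'} {p : ℝ≥0∞} (hf : MemLpLoc f p) {K : Set E3} (hK : IsCompact K) {C : ℝ}
    (hg : AEStronglyMeasurable g volume) (hgf : ∀ x, ‖g x‖ ≤ C * ‖f x‖)
    (hgK : ∀ x, x ∉ K → g x = 0) : MemLp g p volume := by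
  have h1 : MemLp g p (volume.restrict K) :=
    (hf K hK).of_le_mul hg.restrict (Eventually.of_forall hgf)
  have h2 := (memLp_indicator_iff_restrict hK.measurableSet).2 h1
  rwa [Set.indicator_eq_self.2 fun x hx => by_contra fun hxK => hx (hgK x hxK)] at h2

lemma memLp_truncated_deriv {u : E3 → E3} {G : E3 → (E3 →L[ℝ] E3)} (h : HasWeakDeriv u G)
    {χ : E3 → ℝ} (hχ : ContDiff ℝ ∞ χ) (hχc : HasCompactSupport χ) {p : ℝ≥0∞}
    (hu : MemLpLoc u p) (hG : MemLpLoc G p) :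
    MemLp (fun x => χ x • G x + (fderiv ℝ χ x).smulRight (u x)) p volume := by
  have hK : IsCompact (tsupport χ) := hχc
  have hm1 := (h.locallyIntegrable_deriv.continuous_smul hχ.continuous).aestronglyMeasurable
  have h1 : MemLp (fun x => χ x • G x) p volume := by
    obtain ⟨C, hC⟩ := hχ.continuous.bounded_above_of_compact_support hχc
    refine hG.memLp_of_hasCompactSupport hK (C := C) hm1 (fun x => ?_) fun x hx => ?_
    · rw [norm_smul]
      exact mul_le_mul_of_nonneg_right (hC x) (norm_nonneg _)
    · rw [image_eq_zero_of_notMem_tsupport hx]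
      exact zero_smul ℝ (G x)
  have h2 : MemLp (fun x => (fderiv ℝ χ x).smulRight (u x)) p volume := by
    obtain ⟨C, hC⟩ := (hχ.continuous_fderiv (by simp)).bounded_above_of_compact_support
      (hχc.fderiv (𝕜 := ℝ))
    refine hu.memLp_of_hasCompactSupport hK (C := C) ?_ (fun x => ?_) fun x hx => ?_
    · have := (h.smul hχ).locallyIntegrable_deriv.aestronglyMeasurable.sub hm1
      refine this.congr (Eventually.of_forall fun x => ?_)
      exact add_sub_cancel_left _ _
    · rw [ContinuousLinearMap.norm_smulRight_apply]
      exact mul_le_mul_of_nonneg_right (hC x) (norm_nonneg _)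
    · have h0 : fderiv ℝ χ x = 0 := by
        by_contra hne
        exact hx (support_fderiv_subset ℝ hne)
      rw [h0]; ext; simp
  exact MemLp.add (ε := E3 →L[ℝ] E3) h1 h2

lemma three_halves_eq_coe : ((3 / 2 : NNReal) : ℝ≥0∞) = 3 / 2 := by
  rw [ENNReal.coe_div (by norm_num)]; rfl

lemma one_le_three_halves : (1 : ℝ≥0∞) ≤ 3 / 2 := by
  rw [← three_halves_eq_coe, ← ENNReal.coe_one, ENNReal.coe_le_coe]
  rw [← NNReal.coe_le_coe]; norm_num

lemma three_halves_ne_top : (3 / 2 : ℝ≥0∞) ≠ ⊤ := by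
  rw [← three_halves_eq_coe]; exact ENNReal.coe_ne_top

/-- The Sobolev inequality for the exponents `3/2` and `3` in dimension three. -/
lemma eLpNorm_three_le_fderiv {v : E3 → E3} (hv : ContDiff ℝ 1 v) (hc : HasCompactSupport v) :
    eLpNorm v 3 volume ≤ SNormLESNormFDerivOfEqConst E3 (volume : Measure E3) (3 / 2 : NNReal)
      * eLpNorm (fderiv ℝ v) (3 / 2) volume := by
  have h := eLpNorm_le_eLpNorm_fderiv_of_eq (volume : Measure E3) hv hc
    (p := (3 / 2 : NNReal)) (p' := 3) (by rw [← NNReal.coe_le_coe]; norm_num) (by simp)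
    (by simp; norm_num)
  rwa [three_halves_eq_coe] at h

/-- A smooth truncation makes the field compactly supported, so the Sobolev inequality applies to
differences of its mollifications. Their derivatives are Cauchy in `L^{3/2}`, hence the fields are
Cauchy in `L³`; the `L³` limit must be the truncated field, which therefore lies in `L³`. -/
theorem exists_smooth_approximation {u : E3 → E3} {G : E3 → (E3 →L[ℝ] E3)}
    (h : HasWeakDeriv u G) (hu : MemLpLoc u (3 / 2)) (hG : MemLpLoc G (3 / 2)) (R : ℝ) :
    MemLp u 3 (volume.restrict (ball 0 R)) ∧ ∃ v : ℕ → E3 → E3, (∀ n, ContDiff ℝ ∞ (v n)) ∧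
      Tendsto (fun n => eLpNorm (v n - u) (3 / 2) (volume.restrict (ball 0 R))) atTop (𝓝 0) ∧
      Tendsto (fun n => eLpNorm (v n - u) 3 (volume.restrict (ball 0 R))) atTop (𝓝 0) ∧
      Tendsto (fun n => eLpNorm (fderiv ℝ (v n) - G) (3 / 2) (volume.restrict (ball 0 R)))
        atTop (𝓝 0) := by
  -- The absolute value keeps the radii positive for every real `R`.
  let χ : ContDiffBump (0 : E3) := ⟨|R| + 1, |R| + 2, by positivity, by linarith⟩
  have hχ : ContDiff ℝ ∞ χ := χ.contDiff
  set U : E3 → E3 := fun x => χ x • u x with hU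
  set A : E3 → (E3 →L[ℝ] E3) := fun x => χ x • G x + (fderiv ℝ χ x).smulRight (u x) with hA
  have hW : HasWeakDeriv U A := h.smul hχ
  have hχ1 : ∀ x ∈ ball (0 : E3) R, χ =ᶠ[𝓝 x] fun _ => 1 := fun x hx => by
    have hx' : x ∈ ball (0 : E3) (|R| + 1) := by
      have : ‖x‖ < R := by simpa using hx
      simpa using this.trans_le ((le_abs_self R).trans (by linarith))
    filter_upwards [isOpen_ball.mem_nhds hx'] with y hy
    exact χ.one_of_mem_closedBall (ball_subset_closedBall hy)
  have hUu : ∀ x ∈ ball (0 : E3) R, U x = u x := fun x hx => by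
    simp [hU, (hχ1 x hx).eq_of_nhds]
  have hAG : ∀ x ∈ ball (0 : E3) R, A x = G x := fun x hx => by
    simp only [hA, (hχ1 x hx).eq_of_nhds, (hχ1 x hx).fderiv_eq]
    ext; simp
  have hχc := χ.hasCompactSupport
  have hK : IsCompact (tsupport χ) := hχc
  have hUp : MemLp U (3 / 2) volume := by
    refine hu.memLp_of_hasCompactSupport hK (C := 1)
      hW.locallyIntegrable.aestronglyMeasurable (fun x => ?_) fun x hx => ?_
    · rw [hU, norm_smul, Real.norm_of_nonneg χ.nonneg]
      exact mul_le_mul_of_nonneg_right χ.le_one (norm_nonneg _)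
    · simp [hU, image_eq_zero_of_notMem_tsupport hx]
  have hAp : MemLp A (3 / 2) volume := memLp_truncated_deriv h hχ hχc hu hG
  set v : ℕ → E3 → E3 := fun n => mollify (shrinkingBump n) U with hv
  have hUc : HasCompactSupport U := hχc.smul_right
  have hvc : ∀ n, HasCompactSupport (v n) := fun n => hasCompactSupport_mollify _ hUc
  have hvs : ∀ n, ContDiff ℝ ∞ (v n) := fun n => contDiff_mollify _ hW.locallyIntegrable
  have hvs1 : ∀ n, ContDiff ℝ 1 (v n) := fun n => (hvs n).of_le (by norm_cast)
  have hvU := tendsto_eLpNorm_mollify_sub one_le_three_halves three_halves_ne_top hUp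
  have hvA := tendsto_eLpNorm_mollify_sub one_le_three_halves three_halves_ne_top hAp
  have hfd : ∀ n, fderiv ℝ (v n) = mollify (shrinkingBump n) A := fun n => by
    ext1 x; exact fderiv_mollify hW _ x
  have hAm : ∀ n, AEStronglyMeasurable (mollify (shrinkingBump n) A) volume := fun n =>
    (contDiff_mollify _ hW.locallyIntegrable_deriv).continuous.aestronglyMeasurable
  have hcau := tendsto_eLpNorm_sub_sub one_le_three_halves hAm hAp.1 hvA
  have hv3 : ∀ n, MemLp (v n) 3 volume := fun n =>
    (hvs n).continuous.memLp_of_hasCompactSupport (hvc n)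
  have hcau3 : Tendsto (fun n : ℕ × ℕ => eLpNorm (v n.1 - v n.2) 3 volume) atTop (𝓝 0) := by
    set C := SNormLESNormFDerivOfEqConst E3 (volume : Measure E3) (3 / 2 : NNReal)
    have h2 : Tendsto (fun n : ℕ × ℕ => (C : ℝ≥0∞) * eLpNorm (mollify (shrinkingBump n.1) A
        - mollify (shrinkingBump n.2) A) (3 / 2) volume) atTop (𝓝 0) := by
      simpa using ENNReal.Tendsto.const_mul hcau (Or.inr ENNReal.coe_ne_top)
    refine tendsto_of_tendsto_of_tendsto_of_le_of_le tendsto_const_nhds h2 (fun _ => zero_le) ?_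
    intro n
    have := eLpNorm_three_le_fderiv ((hvs1 n.1).sub (hvs1 n.2)) ((hvc n.1).sub (hvc n.2))
    refine this.trans_eq ?_
    congr 2
    ext1 x
    rw [Pi.sub_apply, ← hfd, ← hfd]
    exact fderiv_sub ((hvs1 n.1).differentiable one_ne_zero x)
      ((hvs1 n.2).differentiable one_ne_zero x)
  obtain ⟨w, hw, hvw⟩ := exists_memLp_tendsto (by norm_num) hv3 hcau3
  have hwU : w =ᵐ[volume] U := ae_eq_of_tendsto_eLpNorm (by norm_num)
    (zero_lt_one.trans_le one_le_three_halves).ne' (fun n => (hv3 n).1) hw.1 hUp.1 hvw hvU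
  have hres : ∀ {F : Type} [NormedAddCommGroup F] {f g : E3 → F} {p : ℝ≥0∞},
      (∀ x ∈ ball (0 : E3) R, f x = g x) →
      eLpNorm g p (volume.restrict (ball 0 R)) ≤ eLpNorm f p volume := by
    intro F _ f g p hfg
    refine le_trans (le_of_eq ?_) (eLpNorm_mono_measure f (Measure.restrict_le_self (s := ball 0 R)))
    refine eLpNorm_congr_ae ?_
    filter_upwards [ae_restrict_mem measurableSet_ball] with x hx using (hfg x hx).symm
  refine ⟨?_, v, hvs, ?_, ?_, ?_⟩
  · refine ((hw.ae_eq hwU).restrict (ball 0 R)).ae_eq ?_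
    filter_upwards [ae_restrict_mem measurableSet_ball] with x hx using hUu x hx
  · refine tendsto_eLpNorm_of_le (fun n => hres fun x hx => ?_) hvU
    simp only [Pi.sub_apply, hv, hUu x hx]
  · have hvU3 : Tendsto (fun n => eLpNorm (v n - U) 3 volume) atTop (𝓝 0) := by
      refine hvw.congr fun n => eLpNorm_congr_ae ?_
      exact (ae_eq_refl _).sub hwU
    refine tendsto_eLpNorm_of_le (fun n => hres fun x hx => ?_) hvU3
    simp only [Pi.sub_apply, hUu x hx]
  · refine tendsto_eLpNorm_of_le (fun n => hres fun x hx => ?_) hvA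
    simp only [Pi.sub_apply, hfd, hAG x hx]

/-! ### Integral identities for smooth fields -/

lemma sum_apply_e_mul (L : E3 →L[ℝ] ℝ) (w : E3) : ∑ i, L (e i) * w i = L w := by
  have hw : w = ∑ i, w i • e i := by
    ext j
    simp [e, Fin.sum_univ_three]
    fin_cases j <;> simp
  conv_rhs => rw [hw]
  simp [map_sum, mul_comm]

lemma divOf_add (A B : E3 →L[ℝ] E3) : divOf (A + B) = divOf A + divOf B := by
  simp [divOf, Finset.sum_add_distrib]

lemma divOf_sub (A B : E3 →L[ℝ] E3) : divOf (A - B) = divOf A - divOf B := by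
  simp [divOf, Finset.sum_sub_distrib]

lemma divOf_smul (c : ℝ) (A : E3 →L[ℝ] E3) : divOf (c • A) = c * divOf A := by
  simp [divOf, Finset.mul_sum]

lemma divOf_id : divOf (ContinuousLinearMap.id ℝ E3) = 3 := by
  simp [divOf, e]

lemma hasFDerivAt_fun_id (x : E3) :
    HasFDerivAt (fun x : E3 => x) (ContinuousLinearMap.id ℝ E3) x := hasFDerivAt_id x

lemma divOf_smulRight (L : E3 →L[ℝ] ℝ) (w : E3) : divOf (L.smulRight w) = L w := by
  rw [← sum_apply_e_mul L w]
  simp [divOf]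

lemma divOf_fderiv_smul {f : E3 → ℝ} {v : E3 → E3} {f' : E3 →L[ℝ] ℝ} {v' : E3 →L[ℝ] E3} {x : E3}
    (hf : HasFDerivAt f f' x) (hv : HasFDerivAt v v' x) :
    divOf (fderiv ℝ (fun x => f x • v x) x) = f x * divOf v' + f' (v x) := by
  change divOf (fderiv ℝ (f • v) x) = _
  rw [(hf.smul hv).fderiv, divOf_add, divOf_smul, divOf_smulRight]

/-- The expression `(div A) (w · x) + x · (A w) - w · (A x)`, which for `A = Dw` is the
product of `x` with `(div w) w + curl w × w`. -/
def stressDiv (x : E3) (A : E3 →L[ℝ] E3) (w : E3) : ℝ :=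
  divOf A * inner ℝ w x + inner ℝ x (A w) - inner ℝ w (A x)

/-- Apart from the divergence term, only the antisymmetric part of `A` enters, and that part acts on
`w` as the curl does: the rest is `x · (curl × w)`. Hence the components of `x` are the coefficients
of the linear combination. -/
lemma stressDiv_eq_zero {x : E3} {A : E3 →L[ℝ] E3} {w : E3} (hdiv : divOf A = 0)
    (hcurl : cross (curlOf A) w = 0) : stressDiv x A w = 0 := by
  have h : ∀ i, crossProduct (curlOf A).ofLp w.ofLp i = 0 := fun i => by
    have := congrArg (fun z : E3 => z i) hcurl
    simpa [cross] using this
  have h0 := h 0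
  have h1 := h 1
  have h2 := h 2
  simp [curlOf, crossProduct] at h0 h1 h2
  have hA : ∀ (y : E3) j, A y j = y 0 * A (e 0) j + y 1 * A (e 1) j + y 2 * A (e 2) j := by
    intro y j
    have := sum_apply_e_mul ((EuclideanSpace.proj j : E3 →L[ℝ] ℝ).comp A) y
    simp [Fin.sum_univ_three] at this
    rw [← this]; ring
  rw [stressDiv, hdiv]
  simp only [PiLp.inner_apply, Fin.sum_univ_three, RCLike.inner_apply, conj_trivial]
  rw [hA w, hA w, hA w, hA x, hA x, hA x]
  linear_combination x 0 * h0 + x 1 * h1 + x 2 * h2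

section Weighted

variable {m k : E3 → ℝ} {v : E3 → E3}

/-- The divergence theorem for the field `f x`; on the sphere `x · x = R²`, and one factor `R`
cancels. -/
lemma integral_radial {f : E3 → ℝ} (hf : ContDiff ℝ 1 f) {R : ℝ} (hR : 0 < R) :
    ∫ x in ball 0 R, (3 * f x + fderiv ℝ f x x) = R * ∫ x, f x ∂(surfaceMeasure R) := by
  have h := integral_div_ball (F := fun x => f x • x) (hf.smul contDiff_id) hR
  have h1 : ∀ x, divOf (fderiv ℝ (fun x => f x • x) x) = 3 * f x + fderiv ℝ f x x := fun x => by
    rw [divOf_fderiv_smul (hf.differentiable one_ne_zero x).hasFDerivAt (hasFDerivAt_fun_id x), divOf_id]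
    simp [mul_comm]
  have h2 : ∫ x, inner ℝ (f x • x) x ∂(surfaceMeasure R)
      = R ^ 2 * ∫ x, f x ∂(surfaceMeasure R) := by
    rw [← integral_const_mul]
    refine integral_congr_ae ?_
    filter_upwards [ae_surfaceMeasure_norm_eq hR] with x hx
    simp only [inner_smul_left, real_inner_self_eq_norm_sq, hx, conj_trivial]
    ring
  simp_rw [h1] at h
  rw [h2] at h
  have : R * (R * ∫ x, f x ∂(surfaceMeasure R)) = R ^ 2 * ∫ x, f x ∂(surfaceMeasure R) := by ring
  rw [← this] at h
  exact mul_left_cancel₀ hR.ne' h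

lemma hasFDerivAt_norm_sq_mul (hv : ContDiff ℝ 1 v)
    (hm : ∀ x, HasFDerivAt m (k x • innerSL ℝ x) x) (x : E3) :
    HasFDerivAt (fun x => ‖v x‖ ^ 2 * m x)
      (‖v x‖ ^ 2 • (k x • innerSL ℝ x) + m x • (2 • (innerSL ℝ (v x)).comp (fderiv ℝ v x))) x :=
  ((hv.differentiable one_ne_zero x).hasFDerivAt.norm_sq).mul (hm x)

/-- The integral identity obtained from the field `|v|² m x`. -/
lemma integral_norm_sq_radial (hv : ContDiff ℝ 1 v) (hm1 : ContDiff ℝ 1 m)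
    (hm : ∀ x, HasFDerivAt m (k x • innerSL ℝ x) x) {R : ℝ} (hR : 0 < R) :
    ∫ x in ball 0 R, ((3 * m x + k x * ‖x‖ ^ 2) * ‖v x‖ ^ 2
        + 2 * m x * inner ℝ (v x) (fderiv ℝ v x x))
      = R * ∫ x, m x * ‖v x‖ ^ 2 ∂(surfaceMeasure R) := by
  have h := integral_radial (f := fun x => ‖v x‖ ^ 2 * m x) ((hv.norm_sq ℝ).mul hm1) hR
  have h1 : ∀ x, 3 * (‖v x‖ ^ 2 * m x) + fderiv ℝ (fun x => ‖v x‖ ^ 2 * m x) x x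
      = (3 * m x + k x * ‖x‖ ^ 2) * ‖v x‖ ^ 2 + 2 * m x * inner ℝ (v x) (fderiv ℝ v x x) := by
    intro x
    rw [(hasFDerivAt_norm_sq_mul hv hm x).fderiv]
    simp
    ring
  simp_rw [h1] at h
  rw [h]
  simp_rw [mul_comm]

/-- The integral identity obtained from the field `m (v · x) v - (m |v|² / 2) x`. -/
lemma integral_stress (hv : ContDiff ℝ 1 v) (hm1 : ContDiff ℝ 1 m)
    (hm : ∀ x, HasFDerivAt m (k x • innerSL ℝ x) x) {R : ℝ} (hR : 0 < R) :
    R * ∫ x in ball 0 R, (m x * stressDiv x (fderiv ℝ v x) (v x)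
        + (k x * (inner ℝ (v x) x * inner ℝ (v x) x)
          - (k x * ‖x‖ ^ 2 + m x) / 2 * inner ℝ (v x) (v x)))
      = ∫ x, m x * (inner ℝ (v x) x * inner ℝ (v x) x - ‖x‖ ^ 2 / 2 * inner ℝ (v x) (v x))
          ∂(surfaceMeasure R) := by
  have hvd := hv.differentiable one_ne_zero
  have hF1 : ContDiff ℝ 1 fun x => (inner ℝ (v x) x * m x) • v x :=
    ((hv.inner ℝ contDiff_id).mul hm1).smul hv
  have hF2 : ContDiff ℝ 1 fun x => (‖v x‖ ^ 2 * m x) • x :=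
    ((hv.norm_sq ℝ).mul hm1).smul contDiff_id
  have h := integral_div_ball (hF1.sub (hF2.const_smul (1 / 2 : ℝ))) hR
  convert h using 1
  · congr 1
    refine integral_congr_ae (Eventually.of_forall fun x => ?_)
    have hd1 : HasFDerivAt (fun x => inner ℝ (v x) x * m x) _ x :=
      ((hvd x).hasFDerivAt.inner ℝ (hasFDerivAt_fun_id x)).mul (hm x)
    have hs : fderiv ℝ ((fun x => (inner ℝ (v x) x * m x) • v x)
          - (1 / 2 : ℝ) • fun x => (‖v x‖ ^ 2 * m x) • x) x
        = fderiv ℝ (fun x => (inner ℝ (v x) x * m x) • v x) x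
          - (1 / 2 : ℝ) • fderiv ℝ (fun x => (‖v x‖ ^ 2 * m x) • x) x := by
      rw [fderiv_sub (hF1.differentiable one_ne_zero x)
        ((hF2.differentiable one_ne_zero x).const_smul _),
        fderiv_const_smul (hF2.differentiable one_ne_zero x)]
    change _ = divOf (fderiv ℝ ((fun x => (inner ℝ (v x) x * m x) • v x)
          - (1 / 2 : ℝ) • fun x => (‖v x‖ ^ 2 * m x) • x) x)
    rw [hs, divOf_sub, divOf_smul, divOf_fderiv_smul hd1 (hvd x).hasFDerivAt,
      divOf_fderiv_smul (hasFDerivAt_norm_sq_mul hv hm x) (hasFDerivAt_fun_id x), divOf_id]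
    simp [stressDiv]
    rw [real_inner_comm x (v x), real_inner_comm x (fderiv ℝ v x (v x))]
    ring
  · refine integral_congr_ae (Eventually.of_forall fun x => ?_)
    simp [inner_sub_left, inner_smul_left]
    ring

end Weighted

/-- This is `integral_radial` for `f = |v|`. Since `|v|` need not be differentiable at the zeros of
`v`, it is replaced by `√(|v|² + δ²)`, which exceeds it by at most `δ`. -/
lemma integral_norm_surface_le {v : E3 → E3} (hv : ContDiff ℝ 1 v) {R : ℝ} (hR : 0 < R) :
    R * ∫ x, ‖v x‖ ∂(surfaceMeasure R) ≤ ∫ x in ball 0 R, (3 * ‖v x‖ + R * ‖fderiv ℝ v x‖) := by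
  have hvc := hv.continuous
  have hdc := hv.continuous_fderiv one_ne_zero
  have hib : ∀ {f : E3 → ℝ}, Continuous f → IntegrableOn f (ball 0 R) := fun hf =>
    (hf.continuousOn.integrableOn_compact (isCompact_closedBall (0 : E3) R)).mono_set
      ball_subset_closedBall
  have his : ∀ {f : E3 → ℝ}, Continuous f → Integrable f (surfaceMeasure R) := fun {f} hf => by
    obtain ⟨C, hC⟩ := (isCompact_closedBall (0 : E3) R).exists_bound_of_continuousOn hf.continuousOn
    refine Integrable.of_bound hf.aestronglyMeasurable C ?_
    filter_upwards [ae_surfaceMeasure_norm_eq hR] with x hx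
    exact hC x (by simp [hx])
  have key : ∀ δ : ℝ, 0 < δ → R * ∫ x, ‖v x‖ ∂(surfaceMeasure R)
      ≤ (∫ x in ball 0 R, (3 * ‖v x‖ + R * ‖fderiv ℝ v x‖))
        + δ * (3 * volume.real (ball (0 : E3) R)) := by
    intro δ hδ
    set f : E3 → ℝ := fun x => √(‖v x‖ ^ 2 + δ ^ 2) with hf
    have hpos : ∀ x, 0 < ‖v x‖ ^ 2 + δ ^ 2 := fun x => by positivity
    have hf1 : ContDiff ℝ 1 f := ((hv.norm_sq ℝ).add contDiff_const).sqrt fun x => (hpos x).ne'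
    have hvf : ∀ x, ‖v x‖ ≤ f x := fun x => Real.le_sqrt_of_sq_le (by nlinarith [sq_nonneg δ])
    have hfv : ∀ x, f x ≤ ‖v x‖ + δ := fun x => by
      refine Real.sqrt_le_iff.2 ⟨by positivity, ?_⟩
      nlinarith [norm_nonneg (v x)]
    have hfd : ∀ x ∈ ball (0 : E3) R, fderiv ℝ f x x ≤ R * ‖fderiv ℝ v x‖ := fun x hx => by
      have hx' : ‖x‖ < R := by simpa using hx
      have hfx : 0 < f x := Real.sqrt_pos.2 (hpos x)
      have hd := (((hv.differentiable one_ne_zero x).hasFDerivAt.norm_sq).add_const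
        (δ ^ 2)).sqrt (hpos x).ne'
      have hd' : fderiv ℝ f x x = (f x)⁻¹ * inner ℝ (v x) (fderiv ℝ v x x) := by
        rw [show fderiv ℝ f x = _ from hd.fderiv]
        simp [hf]
        field_simp
      rw [hd', inv_mul_le_iff₀ hfx]
      calc inner ℝ (v x) (fderiv ℝ v x x) ≤ ‖v x‖ * ‖fderiv ℝ v x x‖ := real_inner_le_norm _ _
        _ ≤ f x * (‖fderiv ℝ v x‖ * ‖x‖) := by
            gcongr
            · exact hvf x
            · exact (fderiv ℝ v x).le_opNorm x
        _ ≤ f x * (R * ‖fderiv ℝ v x‖) := by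
            rw [mul_comm R]
            gcongr
    calc R * ∫ x, ‖v x‖ ∂(surfaceMeasure R) ≤ R * ∫ x, f x ∂(surfaceMeasure R) := by
          refine mul_le_mul_of_nonneg_left ?_ hR.le
          exact integral_mono (his hvc.norm) (his hf1.continuous) hvf
      _ = ∫ x in ball 0 R, (3 * f x + fderiv ℝ f x x) := (integral_radial hf1 hR).symm
      _ ≤ ∫ x in ball 0 R, ((3 * ‖v x‖ + R * ‖fderiv ℝ v x‖) + 3 * δ) := by
          refine setIntegral_mono_on (hib ?_) (hib (by fun_prop)) measurableSet_ball fun x hx => ?_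
          · have := hf1.continuous
            have := hf1.continuous_fderiv one_ne_zero
            fun_prop
          · have := hfv x
            have := hfd x hx
            linarith
      _ = _ := by
          rw [integral_add (hib (by fun_prop)) (hib continuous_const), setIntegral_const, smul_eq_mul]
          ring
  refine le_of_forall_pos_le_add fun ε hε => ?_
  set V := 3 * volume.real (ball (0 : E3) R) with hV
  have hV0 : 0 ≤ V := by positivity
  -- Dividing by `V + 1` rather than `V` avoids having to show `V > 0`.
  refine (key (ε / (V + 1)) (by positivity)).trans ?_
  gcongr
  rw [div_mul_eq_mul_div, div_le_iff₀ (by positivity)]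
  nlinarith

/-! ### Passing to the limit in bilinear integrals -/

section Bilinear

variable {F₁ F₂ : Type*} [NormedAddCommGroup F₁] [NormedAddCommGroup F₂] {μ : Measure E3}
  {p q : ℝ≥0∞} [hpq : p.HolderTriple q 1] {b : E3 → F₁ → F₂ → ℝ} {C : NNReal}

lemma eLpNorm_bilinear_le (hbC : ∀ᵐ x ∂μ, ∀ a c, |b x a c| ≤ C * ‖a‖ * ‖c‖) {f : E3 → F₁}
    {g : E3 → F₂} (hf : AEStronglyMeasurable f μ) (hg : AEStronglyMeasurable g μ) :
    eLpNorm (fun x => b x (f x) (g x)) 1 μ ≤ C * eLpNorm f p μ * eLpNorm g q μ := by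
  refine le_trans (eLpNorm_mono_ae (g := fun x => (C : ℝ) * ‖f x‖ * ‖g x‖) ?_)
    (eLpNorm_le_eLpNorm_mul_eLpNorm'_of_norm hf hg (fun a c => (C : ℝ) * ‖a‖ * ‖c‖) C ?_)
  · filter_upwards [hbC] with x hx
    exact (hx _ _).trans (le_abs_self _)
  · exact Eventually.of_forall fun x => by simp

lemma integrable_bilinear (hb : Continuous fun z : E3 × F₁ × F₂ => b z.1 z.2.1 z.2.2)
    (hbC : ∀ᵐ x ∂μ, ∀ a c, |b x a c| ≤ C * ‖a‖ * ‖c‖) {f : E3 → F₁} {g : E3 → F₂}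
    (hf : MemLp f p μ) (hg : MemLp g q μ) : Integrable (fun x => b x (f x) (g x)) μ := by
  rw [← memLp_one_iff_integrable]
  refine ⟨hb.comp_aestronglyMeasurable
    (aestronglyMeasurable_id.prodMk (hf.1.prodMk hg.1)), ?_⟩
  refine (eLpNorm_bilinear_le (p := p) (q := q) hbC hf.1 hg.1).trans_lt ?_
  exact ENNReal.mul_lt_top (ENNReal.mul_lt_top ENNReal.coe_lt_top hf.2) hg.2

/-- The difference is `b (f i - f₀) (g i) + b f₀ (g i - g₀)`, and Hölder's inequality bounds both
terms. The bound on `b` is only asked almost everywhere, so that weights need be bounded only where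
`μ` lives. -/
lemma tendsto_integral_bilinear (hb : Continuous fun z : E3 × F₁ × F₂ => b z.1 z.2.1 z.2.2)
    (hbl : ∀ x a a' c, b x (a - a') c = b x a c - b x a' c)
    (hbr : ∀ x a c c', b x a (c - c') = b x a c - b x a c')
    (hbC : ∀ᵐ x ∂μ, ∀ a c, |b x a c| ≤ C * ‖a‖ * ‖c‖) (hq : 1 ≤ q)
    {ι : Type*} {l : Filter ι} {f : ι → E3 → F₁} {g : ι → E3 → F₂} {f₀ : E3 → F₁} {g₀ : E3 → F₂}
    (hf : ∀ i, MemLp (f i) p μ) (hg : ∀ i, MemLp (g i) q μ)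
    (hf₀ : MemLp f₀ p μ) (hg₀ : MemLp g₀ q μ)
    (hlf : Tendsto (fun i => eLpNorm (f i - f₀) p μ) l (𝓝 0))
    (hlg : Tendsto (fun i => eLpNorm (g i - g₀) q μ) l (𝓝 0)) :
    Tendsto (fun i => ∫ x, b x (f i x) (g i x) ∂μ) l (𝓝 (∫ x, b x (f₀ x) (g₀ x) ∂μ)) := by
  refine tendsto_integral_of_L1' _ (integrable_bilinear (p := p) (q := q) hb hbC hf₀ hg₀).1
    (Eventually.of_forall fun i => integrable_bilinear (p := p) (q := q) hb hbC (hf i) (hg i)) ?_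
  have hm : ∀ {f : E3 → F₁} {g : E3 → F₂}, AEStronglyMeasurable f μ → AEStronglyMeasurable g μ →
      AEStronglyMeasurable (fun x => b x (f x) (g x)) μ := fun hf hg =>
    hb.comp_aestronglyMeasurable (aestronglyMeasurable_id.prodMk (hf.prodMk hg))
  have hbound : ∀ i, eLpNorm ((fun x => b x (f i x) (g i x)) - fun x => b x (f₀ x) (g₀ x)) 1 μ
      ≤ C * eLpNorm (f i - f₀) p μ * (eLpNorm (g i - g₀) q μ + eLpNorm g₀ q μ)
        + C * eLpNorm f₀ p μ * eLpNorm (g i - g₀) q μ := by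
    intro i
    have hdec : ((fun x => b x (f i x) (g i x)) - fun x => b x (f₀ x) (g₀ x))
        = (fun x => b x ((f i - f₀) x) (g i x)) + fun x => b x (f₀ x) ((g i - g₀) x) := by
      funext x
      simp only [Pi.sub_apply, Pi.add_apply, hbl, hbr]
      ring
    rw [hdec]
    refine (eLpNorm_add_le (hm ((hf i).1.sub hf₀.1) (hg i).1) (hm hf₀.1 ((hg i).1.sub hg₀.1))
      le_rfl).trans ?_
    refine add_le_add ((eLpNorm_bilinear_le (p := p) (q := q) hbC ((hf i).1.sub hf₀.1) (hg i).1).trans ?_)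
      (eLpNorm_bilinear_le (p := p) (q := q) hbC hf₀.1 ((hg i).1.sub hg₀.1))
    refine mul_le_mul_right ?_ _
    have : g i = (g i - g₀) + g₀ := by simp
    conv_lhs => rw [this]
    exact eLpNorm_add_le ((hg i).1.sub hg₀.1) hg₀.1 hq
  refine tendsto_of_tendsto_of_tendsto_of_le_of_le tendsto_const_nhds ?_ (fun _ => zero_le) hbound
  have hC : (C : ℝ≥0∞) ≠ ⊤ := ENNReal.coe_ne_top
  have h1 : Tendsto (fun i => (C : ℝ≥0∞) * eLpNorm (f i - f₀) p μ) l (𝓝 0) := by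
    simpa using ENNReal.Tendsto.const_mul hlf (Or.inr hC)
  have h2 : Tendsto (fun i => eLpNorm (g i - g₀) q μ + eLpNorm g₀ q μ) l
      (𝓝 (eLpNorm g₀ q μ)) := by
    simpa using hlg.add_const (eLpNorm g₀ q μ)
  have h3 := ENNReal.Tendsto.mul h1 (Or.inr hg₀.2.ne) h2 (Or.inr ENNReal.zero_ne_top)
  have h4 := ENNReal.Tendsto.const_mul (a := C * eLpNorm f₀ p μ) hlg
    (Or.inr (ENNReal.mul_ne_top hC hf₀.2.ne))
  simpa using h3.add h4

end Bilinear

/-! ### Bounds for the weighted bilinear forms on bounded sets -/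

/-- The quadratic expression `w₁ (a · x) (c · x) + w₂ (a · c)`. -/
def quadForm (w₁ w₂ : E3 → ℝ) (x a c : E3) : ℝ :=
  w₁ x * (inner ℝ a x * inner ℝ c x) + w₂ x * inner ℝ a c

section Forms

variable {μ : Measure E3} {R : ℝ} {w w₁ w₂ : E3 → ℝ}

lemma exists_norm_le_on_ball (hw : Continuous w) (R : ℝ) :
    ∃ C : NNReal, ∀ x : E3, ‖x‖ ≤ R → |w x| ≤ C := by
  obtain ⟨C, hC⟩ := (isCompact_closedBall (0 : E3) R).exists_bound_of_continuousOn hw.continuousOn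
  exact ⟨C.toNNReal, fun x hx => (hC x (by simpa using hx)).trans (Real.le_coe_toNNReal C)⟩

lemma exists_quadForm_bound (hw₁ : Continuous w₁) (hw₂ : Continuous w₂)
    (hμ : ∀ᵐ x ∂μ, ‖x‖ ≤ R) :
    ∃ C : NNReal, ∀ᵐ x ∂μ, ∀ a c, |quadForm w₁ w₂ x a c| ≤ C * ‖a‖ * ‖c‖ := by
  obtain ⟨C₁, h₁⟩ := exists_norm_le_on_ball (w := fun x => |w₁ x| * ‖x‖ ^ 2) (by fun_prop) R
  obtain ⟨C₂, h₂⟩ := exists_norm_le_on_ball hw₂ R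
  refine ⟨C₁ + C₂, ?_⟩
  filter_upwards [hμ] with x hx a c
  have ha : |inner ℝ a x| ≤ ‖a‖ * ‖x‖ := abs_real_inner_le_norm _ _
  have hc : |inner ℝ c x| ≤ ‖c‖ * ‖x‖ := abs_real_inner_le_norm _ _
  have hac : |inner ℝ a c| ≤ ‖a‖ * ‖c‖ := abs_real_inner_le_norm _ _
  have k₁ : |w₁ x| * ‖x‖ ^ 2 ≤ C₁ := (le_abs_self _).trans (h₁ x hx)
  calc |quadForm w₁ w₂ x a c|
      ≤ |w₁ x| * (|inner ℝ a x| * |inner ℝ c x|) + |w₂ x| * |inner ℝ a c| := by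
        rw [quadForm, ← abs_mul, ← abs_mul, ← abs_mul]
        exact abs_add_le _ _
    _ ≤ |w₁ x| * ((‖a‖ * ‖x‖) * (‖c‖ * ‖x‖)) + C₂ * (‖a‖ * ‖c‖) := by
        gcongr
        exact h₂ x hx
    _ = (|w₁ x| * ‖x‖ ^ 2) * (‖a‖ * ‖c‖) + C₂ * (‖a‖ * ‖c‖) := by ring
    _ ≤ C₁ * (‖a‖ * ‖c‖) + C₂ * (‖a‖ * ‖c‖) := by gcongr
    _ = _ := by push_cast; ring

lemma continuous_quadForm (hw₁ : Continuous w₁) (hw₂ : Continuous w₂) :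
    Continuous fun z : E3 × E3 × E3 => quadForm w₁ w₂ z.1 z.2.1 z.2.2 := by
  unfold quadForm
  fun_prop

lemma exists_derivForm_bound (hw : Continuous w) (hμ : ∀ᵐ x ∂μ, ‖x‖ ≤ R) :
    ∃ C : NNReal, ∀ᵐ x ∂μ, ∀ (a : E3) (A : E3 →L[ℝ] E3),
      |w x * inner ℝ a (A x)| ≤ C * ‖a‖ * ‖A‖ := by
  obtain ⟨C, h⟩ := exists_norm_le_on_ball (w := fun x => |w x| * ‖x‖) (by fun_prop) R
  refine ⟨C, ?_⟩
  filter_upwards [hμ] with x hx a A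
  have hC : |w x| * ‖x‖ ≤ C := (le_abs_self _).trans (h x hx)
  calc |w x * inner ℝ a (A x)| ≤ |w x| * (‖a‖ * (‖A‖ * ‖x‖)) := by
        rw [abs_mul]
        gcongr
        refine (abs_real_inner_le_norm _ _).trans ?_
        gcongr
        exact A.le_opNorm x
    _ = (|w x| * ‖x‖) * (‖a‖ * ‖A‖) := by ring
    _ ≤ C * (‖a‖ * ‖A‖) := by gcongr
    _ = _ := by ring

lemma abs_stressDiv_le (x : E3) (A : E3 →L[ℝ] E3) (a : E3) :
    |stressDiv x A a| ≤ 5 * ‖x‖ * ‖A‖ * ‖a‖ := by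
  have he : ∀ i, |A (e i) i| ≤ ‖A‖ := fun i => by
    refine (PiLp.norm_apply_le (A (e i)) i).trans ((A.le_opNorm _).trans ?_)
    simp [e]
  have hd : |divOf A| ≤ 3 * ‖A‖ := by
    rw [divOf]
    refine (Finset.abs_sum_le_sum_abs _ _).trans ?_
    refine (Finset.sum_le_sum fun i _ => he i).trans ?_
    simp
  have h1 : |inner ℝ a x| ≤ ‖a‖ * ‖x‖ := abs_real_inner_le_norm _ _
  have h2 : |inner ℝ x (A a)| ≤ ‖x‖ * (‖A‖ * ‖a‖) :=
    (abs_real_inner_le_norm _ _).trans (by gcongr; exact A.le_opNorm a)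
  have h3 : |inner ℝ a (A x)| ≤ ‖a‖ * (‖A‖ * ‖x‖) :=
    (abs_real_inner_le_norm _ _).trans (by gcongr; exact A.le_opNorm x)
  calc |stressDiv x A a| ≤ |divOf A * inner ℝ a x| + |inner ℝ x (A a)| + |inner ℝ a (A x)| := by
        rw [stressDiv]
        exact (abs_sub _ _).trans (by gcongr; exact abs_add_le _ _)
    _ ≤ (3 * ‖A‖) * (‖a‖ * ‖x‖) + ‖x‖ * (‖A‖ * ‖a‖) + ‖a‖ * (‖A‖ * ‖x‖) := by
        rw [abs_mul]
        gcongr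
    _ = _ := by ring

lemma exists_stressDiv_bound (hw : Continuous w) (hμ : ∀ᵐ x ∂μ, ‖x‖ ≤ R) :
    ∃ C : NNReal, ∀ᵐ x ∂μ, ∀ (A : E3 →L[ℝ] E3) (a : E3),
      |w x * stressDiv x A a| ≤ C * ‖A‖ * ‖a‖ := by
  obtain ⟨C, h⟩ := exists_norm_le_on_ball (w := fun x => |w x| * (5 * ‖x‖)) (by fun_prop) R
  refine ⟨C, ?_⟩
  filter_upwards [hμ] with x hx A a
  have hC : |w x| * (5 * ‖x‖) ≤ C := (le_abs_self _).trans (h x hx)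
  calc |w x * stressDiv x A a| ≤ |w x| * (5 * ‖x‖ * ‖A‖ * ‖a‖) := by
        rw [abs_mul]
        gcongr
        exact abs_stressDiv_le x A a
    _ = (|w x| * (5 * ‖x‖)) * (‖A‖ * ‖a‖) := by ring
    _ ≤ C * (‖A‖ * ‖a‖) := by gcongr
    _ = _ := by ring

end Forms

/-! ### Smooth approximations of a Sobolev field and of its trace -/

instance holderTriple_three_halves_three : ENNReal.HolderTriple (3 / 2) 3 1 := by
  refine ⟨?_⟩
  rw [ENNReal.inv_div (by simp) (by simp), inv_one, ← one_div, ← ENNReal.add_div]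
  norm_num
  exact ENNReal.div_self (by norm_num) (by norm_num)

instance holderTriple_three_three_halves : ENNReal.HolderTriple 3 (3 / 2) 1 := .symm

/-- The smooth fields `v n` converge to `u` in `W^{1,3/2}` and in `L^3` of the ball of radius `R`,
and their restrictions to the sphere converge to `g` in `L^2`. -/
structure SmoothApprox (u : E3 → E3) (G : E3 → (E3 →L[ℝ] E3)) (R : ℝ) (v : ℕ → E3 → E3)
    (g : E3 → E3) : Prop where
  pos : 0 < R
  contDiff : ∀ n, ContDiff ℝ ∞ (v n)
  memLp : MemLp u (3 / 2) (volume.restrict (ball 0 R))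
  memLp_three : MemLp u 3 (volume.restrict (ball 0 R))
  memLp_deriv : MemLp G (3 / 2) (volume.restrict (ball 0 R))
  memLp_trace : MemLp g 2 (surfaceMeasure R)
  tendsto : Tendsto (fun n => eLpNorm (v n - u) (3 / 2) (volume.restrict (ball 0 R))) atTop (𝓝 0)
  tendsto_three : Tendsto (fun n => eLpNorm (v n - u) 3 (volume.restrict (ball 0 R))) atTop (𝓝 0)
  tendsto_deriv : Tendsto (fun n => eLpNorm (fderiv ℝ (v n) - G) (3 / 2)
    (volume.restrict (ball 0 R))) atTop (𝓝 0)
  tendsto_trace : Tendsto (fun n => eLpNorm (v n - g) 2 (surfaceMeasure R)) atTop (𝓝 0)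

instance isFiniteMeasure_restrict_ball (R : ℝ) :
    IsFiniteMeasure ((volume : Measure E3).restrict (ball 0 R)) :=
  ⟨by simpa using measure_ball_lt_top (μ := (volume : Measure E3)) (x := 0) (r := R)⟩

lemma _root_.Continuous.memLp_ball {F : Type*} [NormedAddCommGroup F]
    [SecondCountableTopologyEither E3 F] {f : E3 → F}
    (hf : Continuous f) (p : ℝ≥0∞) (R : ℝ) : MemLp f p (volume.restrict (ball 0 R)) := by
  obtain ⟨C, hC⟩ := (isCompact_closedBall (0 : E3) R).exists_bound_of_continuousOn hf.continuousOn
  refine MemLp.of_bound hf.aestronglyMeasurable C ?_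
  filter_upwards [ae_restrict_mem measurableSet_ball] with x hx
  exact hC x (ball_subset_closedBall hx)

lemma _root_.Continuous.memLp_surface {F : Type*} [NormedAddCommGroup F]
    [SecondCountableTopologyEither E3 F] {f : E3 → F}
    (hf : Continuous f) (p : ℝ≥0∞) {R : ℝ} (hR : 0 < R) : MemLp f p (surfaceMeasure R) := by
  obtain ⟨C, hC⟩ := (isCompact_closedBall (0 : E3) R).exists_bound_of_continuousOn hf.continuousOn
  refine MemLp.of_bound hf.aestronglyMeasurable C ?_
  filter_upwards [ae_surfaceMeasure_norm_eq hR] with x hx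
  exact hC x (by simp [hx])

lemma ae_ball_norm_le (R : ℝ) : ∀ᵐ x ∂((volume : Measure E3).restrict (ball 0 R)), ‖x‖ ≤ R := by
  filter_upwards [ae_restrict_mem measurableSet_ball] with x hx
  simpa using (ball_subset_closedBall hx)

lemma ae_surface_norm_le {R : ℝ} (hR : 0 < R) : ∀ᵐ x ∂(surfaceMeasure R), ‖x‖ ≤ R := by
  filter_upwards [ae_surfaceMeasure_norm_eq hR] with x hx using hx.le

/-! ### Integrability and continuity of the weighted forms -/

section QuadLimits

variable {μ : Measure E3} {R : ℝ} {w w₁ w₂ : E3 → ℝ} {p q : ℝ≥0∞} [p.HolderTriple q 1]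
  {ι : Type*} {l : Filter ι}

lemma integrable_quadForm (hw₁ : Continuous w₁) (hw₂ : Continuous w₂) (hμ : ∀ᵐ x ∂μ, ‖x‖ ≤ R)
    {u u' : E3 → E3} (hu : MemLp u p μ) (hu' : MemLp u' q μ) :
    Integrable (fun x => quadForm w₁ w₂ x (u x) (u' x)) μ := by
  obtain ⟨C, hC⟩ := exists_quadForm_bound hw₁ hw₂ hμ
  exact integrable_bilinear (p := p) (q := q) (continuous_quadForm hw₁ hw₂) hC hu hu'

lemma tendsto_integral_quadForm (hw₁ : Continuous w₁) (hw₂ : Continuous w₂)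
    (hμ : ∀ᵐ x ∂μ, ‖x‖ ≤ R) (hq : 1 ≤ q) {v : ι → E3 → E3} {u : E3 → E3}
    (hvp : ∀ n, MemLp (v n) p μ) (hvq : ∀ n, MemLp (v n) q μ)
    (hup : MemLp u p μ) (huq : MemLp u q μ)
    (hlp : Tendsto (fun n => eLpNorm (v n - u) p μ) l (𝓝 0))
    (hlq : Tendsto (fun n => eLpNorm (v n - u) q μ) l (𝓝 0)) :
    Tendsto (fun n => ∫ x, quadForm w₁ w₂ x (v n x) (v n x) ∂μ) l
      (𝓝 (∫ x, quadForm w₁ w₂ x (u x) (u x) ∂μ)) := by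
  obtain ⟨C, hC⟩ := exists_quadForm_bound hw₁ hw₂ hμ
  refine tendsto_integral_bilinear (p := p) (q := q) (continuous_quadForm hw₁ hw₂) ?_ ?_ hC hq
    hvp hvq hup huq hlp hlq
  · intro x a a' c
    simp only [quadForm, inner_sub_left]; ring
  · intro x a c c'
    simp only [quadForm, inner_sub_left, inner_sub_right]; ring

lemma integrable_derivForm (hw : Continuous w) (hμ : ∀ᵐ x ∂μ, ‖x‖ ≤ R)
    {u : E3 → E3} {G : E3 → (E3 →L[ℝ] E3)} (hu : MemLp u p μ) (hG : MemLp G q μ) :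
    Integrable (fun x => w x * inner ℝ (u x) (G x x)) μ := by
  obtain ⟨C, hC⟩ := exists_derivForm_bound hw hμ
  exact integrable_bilinear (p := p) (q := q)
    (b := fun x a (A : E3 →L[ℝ] E3) => w x * inner ℝ a (A x)) (by fun_prop) hC hu hG

lemma tendsto_integral_derivForm (hw : Continuous w) (hμ : ∀ᵐ x ∂μ, ‖x‖ ≤ R) (hq : 1 ≤ q)
    {v : ι → E3 → E3} {u : E3 → E3} {A : ι → E3 → (E3 →L[ℝ] E3)} {G : E3 → (E3 →L[ℝ] E3)}
    (hv : ∀ n, MemLp (v n) p μ) (hA : ∀ n, MemLp (A n) q μ) (hu : MemLp u p μ) (hG : MemLp G q μ)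
    (hlv : Tendsto (fun n => eLpNorm (v n - u) p μ) l (𝓝 0))
    (hlA : Tendsto (fun n => eLpNorm (A n - G) q μ) l (𝓝 0)) :
    Tendsto (fun n => ∫ x, w x * inner ℝ (v n x) (A n x x) ∂μ) l
      (𝓝 (∫ x, w x * inner ℝ (u x) (G x x) ∂μ)) := by
  obtain ⟨C, hC⟩ := exists_derivForm_bound hw hμ
  refine tendsto_integral_bilinear (p := p) (q := q)
    (b := fun x a (A : E3 →L[ℝ] E3) => w x * inner ℝ a (A x)) (by fun_prop) ?_ ?_ hC hq
    hv hA hu hG hlv hlA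
  · intro x a a' B
    simp only [inner_sub_left]; ring
  · intro x a B B'
    simp only [sub_apply, inner_sub_right]; ring

lemma continuous_stressForm (hw : Continuous w) :
    Continuous fun z : E3 × (E3 →L[ℝ] E3) × E3 => w z.1 * stressDiv z.1 z.2.1 z.2.2 := by
  have := continuous_divOf
  unfold stressDiv
  fun_prop

lemma integrable_stressDiv (hw : Continuous w) (hμ : ∀ᵐ x ∂μ, ‖x‖ ≤ R)
    {u : E3 → E3} {G : E3 → (E3 →L[ℝ] E3)} (hG : MemLp G p μ) (hu : MemLp u q μ) :
    Integrable (fun x => w x * stressDiv x (G x) (u x)) μ := by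
  obtain ⟨C, hC⟩ := exists_stressDiv_bound hw hμ
  exact integrable_bilinear (p := p) (q := q)
    (b := fun x (A : E3 →L[ℝ] E3) a => w x * stressDiv x A a)
    (continuous_stressForm hw) hC hG hu

lemma tendsto_integral_stressDiv (hw : Continuous w) (hμ : ∀ᵐ x ∂μ, ‖x‖ ≤ R) (hq : 1 ≤ q)
    {v : ι → E3 → E3} {u : E3 → E3} {A : ι → E3 → (E3 →L[ℝ] E3)} {G : E3 → (E3 →L[ℝ] E3)}
    (hA : ∀ n, MemLp (A n) p μ) (hv : ∀ n, MemLp (v n) q μ) (hG : MemLp G p μ) (hu : MemLp u q μ)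
    (hlA : Tendsto (fun n => eLpNorm (A n - G) p μ) l (𝓝 0))
    (hlv : Tendsto (fun n => eLpNorm (v n - u) q μ) l (𝓝 0)) :
    Tendsto (fun n => ∫ x, w x * stressDiv x (A n x) (v n x) ∂μ) l
      (𝓝 (∫ x, w x * stressDiv x (G x) (u x) ∂μ)) := by
  obtain ⟨C, hC⟩ := exists_stressDiv_bound hw hμ
  refine tendsto_integral_bilinear (p := p) (q := q)
    (b := fun x (A : E3 →L[ℝ] E3) a => w x * stressDiv x A a)
    (continuous_stressForm hw) ?_ ?_ hC hq hA hv hG hu hlA hlv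
  · intro x B B' a
    simp only [stressDiv, divOf_sub, sub_apply, inner_sub_right]; ring
  · intro x B a a'
    simp only [stressDiv, inner_sub_left, map_sub, inner_sub_right]; ring

end QuadLimits

/-- The quantity controlling the trace in `L^2` vanishes in the limit for differences of an
approximating sequence. -/
lemma tendsto_eLpNorm_surface_sub {u : E3 → E3} {G : E3 → (E3 →L[ℝ] E3)} {R : ℝ} (hR : 0 < R)
    {v : ℕ → E3 → E3} (hv : ∀ n, ContDiff ℝ ∞ (v n))
    (hu : MemLp u (3 / 2) (volume.restrict (ball 0 R)))
    (hu3 : MemLp u 3 (volume.restrict (ball 0 R)))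
    (hG : MemLp G (3 / 2) (volume.restrict (ball 0 R)))
    (h1 : Tendsto (fun n => eLpNorm (v n - u) (3 / 2) (volume.restrict (ball 0 R))) atTop (𝓝 0))
    (h3 : Tendsto (fun n => eLpNorm (v n - u) 3 (volume.restrict (ball 0 R))) atTop (𝓝 0))
    (hd : Tendsto (fun n => eLpNorm (fderiv ℝ (v n) - G) (3 / 2)
      (volume.restrict (ball 0 R))) atTop (𝓝 0)) :
    Tendsto (fun n : ℕ × ℕ => eLpNorm (v n.1 - v n.2) 2 (surfaceMeasure R)) atTop (𝓝 0) := by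
  have hv1 : ∀ n, ContDiff ℝ 1 (v n) := fun n => (hv n).of_le (by norm_cast)
  have hvc : ∀ n, Continuous (v n) := fun n => (hv n).continuous
  have hdc : ∀ n, Continuous (fderiv ℝ (v n)) := fun n => (hv1 n).continuous_fderiv one_ne_zero
  have hne3 : (1 : ℝ≥0∞) ≤ 3 := by norm_num
  have c1 := tendsto_eLpNorm_sub_sub one_le_three_halves
    (fun n => (hvc n).aestronglyMeasurable) hu.1 h1
  have c3 := tendsto_eLpNorm_sub_sub hne3 (fun n => (hvc n).aestronglyMeasurable) hu3.1 h3
  have cd := tendsto_eLpNorm_sub_sub one_le_three_halves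
    (fun n => (hdc n).aestronglyMeasurable) hG.1 hd
  have m : ∀ (n : ℕ × ℕ) p, MemLp (v n.1 - v n.2) p (volume.restrict (ball 0 R)) := fun n p =>
    ((hvc n.1).sub (hvc n.2)).memLp_ball p R
  have md : ∀ (n : ℕ × ℕ) p, MemLp (fderiv ℝ (v n.1) - fderiv ℝ (v n.2)) p
      (volume.restrict (ball 0 R)) := fun n p => ((hdc n.1).sub (hdc n.2)).memLp_ball p R
  -- For `w = v n.1 - v n.2`, the terms `3 |w|²` and `2 w · (Dw x)` are the divergence of `|w|² x`.
  -- Both integrals tend to their value at the zero field.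
  have t1 := tendsto_integral_quadForm (w₁ := fun _ => 0) (w₂ := fun _ => 3) (p := 3 / 2) (q := 3)
    (u := 0) continuous_const continuous_const (ae_ball_norm_le R) hne3
    (fun n => m n _) (fun n => m n _) MemLp.zero MemLp.zero (by simpa using c1) (by simpa using c3)
  have t2 := tendsto_integral_derivForm (w := fun _ => 2) (p := 3) (q := 3 / 2) (u := 0) (G := 0)
    continuous_const (ae_ball_norm_le R) one_le_three_halves
    (fun n => m n _) (fun n => md n _) MemLp.zero (MemLp.zero (ε := E3 →L[ℝ] E3)) (by simpa using c3)
    (by simpa only [sub_zero] using cd)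
  have t3 := t1.add t2
  have hkey : ∀ n : ℕ × ℕ,
      (∫ x in ball 0 R, quadForm (fun _ => 0) (fun _ => 3) x ((v n.1 - v n.2) x)
          ((v n.1 - v n.2) x))
        + ∫ x in ball 0 R, 2 * inner ℝ ((v n.1 - v n.2) x)
          ((fderiv ℝ (v n.1) - fderiv ℝ (v n.2)) x x)
      = R * ∫ x, ‖(v n.1 - v n.2) x‖ ^ 2 ∂(surfaceMeasure R) := by
    intro n
    have h := integral_norm_sq_radial (v := v n.1 - v n.2) (m := fun _ => 1) (k := fun _ => 0)
      ((hv1 n.1).sub (hv1 n.2)) contDiff_const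
      (fun x => by simpa using hasFDerivAt_const (1 : ℝ) x) hR
    rw [← integral_add]
    · simp only [one_mul] at h
      rw [← h]
      refine integral_congr_ae (Eventually.of_forall fun x => ?_)
      have : fderiv ℝ (v n.1 - v n.2) x = fderiv ℝ (v n.1) x - fderiv ℝ (v n.2) x :=
        fderiv_sub ((hv1 n.1).differentiable one_ne_zero x)
          ((hv1 n.2).differentiable one_ne_zero x)
      simp only [quadForm, this, real_inner_self_eq_norm_sq]
      simp
    · exact integrable_quadForm (p := 3 / 2) (q := 3) continuous_const continuous_const
        (ae_ball_norm_le R) (m n _) (m n _)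
    · exact integrable_derivForm (p := 3) (q := 3 / 2) (w := fun _ => 2) continuous_const
        (ae_ball_norm_le R) (m n _) (md n _)
  simp_rw [hkey] at t3
  have t4 : Tendsto (fun n : ℕ × ℕ => ∫ x, ‖(v n.1 - v n.2) x‖ ^ 2 ∂(surfaceMeasure R))
      atTop (𝓝 0) := by
    have := t3.const_mul R⁻¹
    simpa [quadForm, hR.ne'] using this
  have t5 : Tendsto (fun n : ℕ × ℕ =>
      ENNReal.ofReal ((∫ x, ‖(v n.1 - v n.2) x‖ ^ 2 ∂(surfaceMeasure R)) ^ (2 : ℝ)⁻¹))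
      atTop (𝓝 0) := by
    have := ENNReal.tendsto_ofReal (t4.rpow_const (p := (2 : ℝ)⁻¹) (Or.inr (by norm_num)))
    simpa using this
  refine t5.congr fun n => ?_
  rw [(((hvc n.1).sub (hvc n.2)).memLp_surface 2 hR).eLpNorm_eq_integral_rpow_norm
    (by norm_num) (by norm_num)]
  simp

theorem exists_smoothApprox {u : E3 → E3} {G : E3 → (E3 →L[ℝ] E3)} (h : HasWeakDeriv u G)
    (hu : MemLpLoc u (3 / 2)) (hG : MemLpLoc G (3 / 2)) {R : ℝ} (hR : 0 < R) :
    ∃ v g, SmoothApprox u G R v g := by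
  obtain ⟨hu3, v, hv, h1, h3, hd⟩ := exists_smooth_approximation h hu hG R
  have hball : (volume : Measure E3).restrict (ball 0 R) ≤ volume.restrict (closedBall 0 R) :=
    Measure.restrict_mono ball_subset_closedBall le_rfl
  have hu1 := (hu _ (isCompact_closedBall 0 R)).mono_measure hball
  have hG1 := (hG _ (isCompact_closedBall 0 R)).mono_measure hball
  obtain ⟨g, hg, hvg⟩ := exists_memLp_tendsto (by norm_num)
    (fun n => (hv n).continuous.memLp_surface 2 hR)
    (tendsto_eLpNorm_surface_sub hR hv hu1 hu3 hG1 h1 h3 hd)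
  exact ⟨v, g, hR, hv, hu1, hu3, hG1, hg, h1, h3, hd, hvg⟩

/-! ### Identities for the Sobolev field -/

section Limit

variable {u : E3 → E3} {G : E3 → (E3 →L[ℝ] E3)} {R : ℝ} {v : ℕ → E3 → E3} {g : E3 → E3}
  {m k : E3 → ℝ}

lemma SmoothApprox.contDiff_one (h : SmoothApprox u G R v g) (n : ℕ) : ContDiff ℝ 1 (v n) :=
  (h.contDiff n).of_le (by norm_cast)

lemma SmoothApprox.memLp_ball (h : SmoothApprox u G R v g) (n : ℕ) (p : ℝ≥0∞) :
    MemLp (v n) p (volume.restrict (ball 0 R)) := (h.contDiff n).continuous.memLp_ball p R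

lemma SmoothApprox.memLp_fderiv_ball (h : SmoothApprox u G R v g) (n : ℕ) (p : ℝ≥0∞) :
    MemLp (fderiv ℝ (v n)) p (volume.restrict (ball 0 R)) :=
  ((h.contDiff_one n).continuous_fderiv one_ne_zero).memLp_ball p R

lemma SmoothApprox.tendsto_surface (h : SmoothApprox u G R v g) {w₁ w₂ : E3 → ℝ}
    (hw₁ : Continuous w₁) (hw₂ : Continuous w₂) :
    Tendsto (fun n => ∫ x, quadForm w₁ w₂ x (v n x) (v n x) ∂(surfaceMeasure R)) atTop
      (𝓝 (∫ x, quadForm w₁ w₂ x (g x) (g x) ∂(surfaceMeasure R))) :=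
  tendsto_integral_quadForm (p := 2) (q := 2) hw₁ hw₂ (ae_surface_norm_le h.pos) (by norm_num)
    (fun n => (h.contDiff n).continuous.memLp_surface 2 h.pos)
    (fun n => (h.contDiff n).continuous.memLp_surface 2 h.pos)
    h.memLp_trace h.memLp_trace h.tendsto_trace h.tendsto_trace

lemma SmoothApprox.tendsto_ball (h : SmoothApprox u G R v g) {w₁ w₂ : E3 → ℝ}
    (hw₁ : Continuous w₁) (hw₂ : Continuous w₂) :
    Tendsto (fun n => ∫ x in ball 0 R, quadForm w₁ w₂ x (v n x) (v n x)) atTop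
      (𝓝 (∫ x in ball 0 R, quadForm w₁ w₂ x (u x) (u x))) :=
  tendsto_integral_quadForm (p := 3 / 2) (q := 3) hw₁ hw₂ (ae_ball_norm_le R) (by norm_num)
    (fun n => h.memLp_ball n _) (fun n => h.memLp_ball n _) h.memLp h.memLp_three
    h.tendsto h.tendsto_three

lemma SmoothApprox.integral_norm_sq_radial (h : SmoothApprox u G R v g) (hm1 : ContDiff ℝ 1 m)
    (hk : Continuous k) (hm : ∀ x, HasFDerivAt m (k x • innerSL ℝ x) x) :
    (∫ x in ball 0 R, (3 * m x + k x * ‖x‖ ^ 2) * ‖u x‖ ^ 2)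
        + ∫ x in ball 0 R, 2 * m x * inner ℝ (u x) (G x x)
      = R * ∫ x, m x * ‖g x‖ ^ 2 ∂(surfaceMeasure R) := by
  have hmc := hm1.continuous
  have hw : Continuous fun x => 3 * m x + k x * ‖x‖ ^ 2 := by fun_prop
  have hm2 : Continuous fun x => 2 * m x := by fun_prop
  have t1 := h.tendsto_ball (w₁ := fun _ => 0) continuous_const hw
  have t2 := tendsto_integral_derivForm (p := 3) (q := 3 / 2) hm2 (ae_ball_norm_le R)
    one_le_three_halves (fun n => h.memLp_ball n _) (fun n => h.memLp_fderiv_ball n _)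
    h.memLp_three h.memLp_deriv h.tendsto_three h.tendsto_deriv
  have t3 := (h.tendsto_surface (w₁ := fun _ => 0) continuous_const hmc).const_mul R
  have hq : ∀ (w : E3 → ℝ) (x a : E3), quadForm (fun _ => 0) w x a a = w x * ‖a‖ ^ 2 := by
    intro w x a
    simp only [quadForm, real_inner_self_eq_norm_sq, zero_mul, zero_add]
  simp only [hq] at t1 t3
  refine tendsto_nhds_unique (t1.add t2) (t3.congr fun n => ?_)
  rw [← Beltrami.integral_norm_sq_radial (h.contDiff_one n) hm1 hm h.pos, integral_add]
  · have := integrable_quadForm (p := 3 / 2) (q := 3) (w₁ := fun _ => 0) continuous_const hw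
      (ae_ball_norm_le R) (h.memLp_ball n _) (h.memLp_ball n _)
    simpa only [hq] using this
  · exact integrable_derivForm (p := 3) (q := 3 / 2) hm2 (ae_ball_norm_le R) (h.memLp_ball n _)
      (h.memLp_fderiv_ball n _)

/-- The approximating fields are not Beltrami flows, but the integral of their stress term tends to
that of `u`, which vanishes. -/
lemma SmoothApprox.integral_stress (h : SmoothApprox u G R v g) (hm1 : ContDiff ℝ 1 m)
    (hk : Continuous k) (hm : ∀ x, HasFDerivAt m (k x • innerSL ℝ x) x)
    (hG : ∀ᵐ x, stressDiv x (G x) (u x) = 0) :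
    R * ∫ x in ball 0 R, quadForm k (fun x => -((k x * ‖x‖ ^ 2 + m x) / 2)) x (u x) (u x)
      = ∫ x, quadForm m (fun x => -(m x * (‖x‖ ^ 2 / 2))) x (g x) (g x) ∂(surfaceMeasure R) := by
  have hmc := hm1.continuous
  have hw : Continuous fun x => -((k x * ‖x‖ ^ 2 + m x) / 2) := by fun_prop
  have hw' : Continuous fun x => -(m x * (‖x‖ ^ 2 / 2)) := by fun_prop
  have t1 := h.tendsto_ball hk hw
  have t2 := tendsto_integral_stressDiv (p := 3 / 2) (q := 3) hmc (ae_ball_norm_le R)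
    (by norm_num) (fun n => h.memLp_fderiv_ball n _) (fun n => h.memLp_ball n _)
    h.memLp_deriv h.memLp_three h.tendsto_deriv h.tendsto_three
  have h0 : ∫ x in ball 0 R, m x * stressDiv x (G x) (u x) = 0 := by
    refine integral_eq_zero_of_ae ?_
    filter_upwards [ae_restrict_of_ae hG] with x hx
    simp [hx]
  rw [h0] at t2
  have t3 := (t2.add t1).const_mul R
  rw [zero_add] at t3
  refine tendsto_nhds_unique t3 ((h.tendsto_surface hmc hw').congr fun n => ?_)
  have hs := Beltrami.integral_stress (h.contDiff_one n) hm1 hm h.pos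
  rw [← integral_add]
  · convert hs.symm using 1
    · refine integral_congr_ae (Eventually.of_forall fun x => ?_)
      simp only [quadForm]; ring
    · congr 1
      refine integral_congr_ae (Eventually.of_forall fun x => ?_)
      simp only [quadForm]; ring
  · exact integrable_stressDiv (p := 3 / 2) (q := 3) hmc (ae_ball_norm_le R)
      (h.memLp_fderiv_ball n _) (h.memLp_ball n _)
  · exact integrable_quadForm (p := 3 / 2) (q := 3) hk hw (ae_ball_norm_le R) (h.memLp_ball n _)
      (h.memLp_ball n _)

end Limit

/-! ### Regularized power weights -/

/-- The smooth weight `(|x|² + ε²)^b`. -/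
def regPow (ε b : ℝ) (x : E3) : ℝ := (‖x‖ ^ 2 + ε ^ 2) ^ b

lemma regBase_pos {ε : ℝ} (hε : 0 < ε) (x : E3) : 0 < ‖x‖ ^ 2 + ε ^ 2 := by positivity

lemma contDiff_regPow {ε : ℝ} (hε : 0 < ε) (b : ℝ) : ContDiff ℝ 1 (regPow ε b) :=
  ((contDiff_norm_sq ℝ).add contDiff_const).rpow_const_of_ne fun x => (regBase_pos hε x).ne'

lemma hasFDerivAt_regPow {ε : ℝ} (hε : 0 < ε) (b : ℝ) (x : E3) :
    HasFDerivAt (regPow ε b) ((2 * b * regPow ε (b - 1) x) • innerSL ℝ x) x := by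
  have h := (((hasStrictFDerivAt_norm_sq x).hasFDerivAt).add_const (ε ^ 2)).rpow_const
    (p := b) (Or.inl (regBase_pos hε x).ne')
  refine h.congr_fderiv ?_
  ext y
  simp [regPow]
  ring

lemma regPow_pos {ε : ℝ} (hε : 0 < ε) (b : ℝ) (x : E3) : 0 < regPow ε b x :=
  Real.rpow_pos_of_pos (regBase_pos hε x) b

lemma regPow_sub_one_mul {ε : ℝ} (hε : 0 < ε) (b : ℝ) (x : E3) :
    regPow ε (b - 1) x * (‖x‖ ^ 2 + ε ^ 2) = regPow ε b x := by
  rw [regPow, regPow, Real.rpow_sub_one (regBase_pos hε x).ne',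
    div_mul_cancel₀ _ (regBase_pos hε x).ne']

lemma regPow_sub_one_mul_le {ε : ℝ} (hε : 0 < ε) (b : ℝ) (x : E3) :
    regPow ε (b - 1) x * ‖x‖ ^ 2 ≤ regPow ε b x := by
  rw [← regPow_sub_one_mul hε b x]
  have := regPow_pos hε (b - 1) x
  gcongr
  nlinarith [sq_nonneg ε]

lemma rpow_norm_sq {x : E3} (b : ℝ) : (‖x‖ ^ 2) ^ b = ‖x‖ ^ (2 * b) := by
  rw [Real.rpow_mul (norm_nonneg x), Real.rpow_two]

lemma regPow_le_of_nonpos {ε : ℝ} {b : ℝ} (hb : b ≤ 0) {x : E3} (hx : x ≠ 0) :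
    regPow ε b x ≤ ‖x‖ ^ (2 * b) := by
  rw [← rpow_norm_sq, regPow]
  have : 0 < ‖x‖ := norm_pos_iff.2 hx
  exact Real.rpow_le_rpow_of_nonpos (by positivity) (by nlinarith [sq_nonneg ε]) hb

lemma regPow_le_of_nonneg {ε R : ℝ} (hε : 0 ≤ ε) (hε1 : ε ≤ 1) {b : ℝ} (hb : 0 ≤ b) {x : E3}
    (hx : ‖x‖ ≤ R) : regPow ε b x ≤ (R ^ 2 + 1) ^ b := by
  refine Real.rpow_le_rpow (by positivity) ?_ hb
  have : 0 ≤ ‖x‖ := norm_nonneg x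
  nlinarith

lemma tendsto_regPow (b : ℝ) {x : E3} (hx : x ≠ 0) :
    Tendsto (fun ε => regPow ε b x) (𝓝[>] 0) (𝓝 (‖x‖ ^ (2 * b))) := by
  have h0 : (fun ε : ℝ => ‖x‖ ^ 2 + ε ^ 2) 0 ≠ 0 := by simpa using hx
  have h1 : ContinuousAt (fun ε : ℝ => (‖x‖ ^ 2 + ε ^ 2) ^ b) 0 :=
    ContinuousAt.rpow_const (by fun_prop) (Or.inl h0)
  have h2 := h1.tendsto.mono_left (nhdsWithin_le_nhds (s := Set.Ioi (0 : ℝ)))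
  simpa [regPow, rpow_norm_sq] using h2

lemma ae_ne_zero_E3 : ∀ᵐ x : E3, x ≠ 0 := by
  have : ∀ᵐ x : E3, x ∉ ({0} : Set E3) := measure_eq_zero_iff_ae_notMem.1 (measure_singleton _)
  simpa using this

lemma norm_normalPart_sq (u : E3 → E3) (x : E3) :
    ‖normalPart u x‖ ^ 2 = inner ℝ (u x) x ^ 2 / ‖x‖ ^ 2 := by
  by_cases hx : x = 0
  · simp [normalPart, hx]
  · have : ‖x‖ ≠ 0 := by simpa using hx
    simp only [normalPart, inner_smul_right, norm_smul, norm_mul, norm_inv,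
      Real.norm_eq_abs, mul_pow, sq_abs, inv_pow]
    field_simp

lemma norm_normalPart_le (u : E3 → E3) (x : E3) : ‖normalPart u x‖ ≤ ‖u x‖ := by
  refine le_of_sq_le_sq ?_ (norm_nonneg _)
  rw [norm_normalPart_sq]
  refine div_le_of_le_mul₀ (by positivity) (by positivity) ?_
  rw [← mul_pow, sq_le_sq, abs_of_nonneg (by positivity : 0 ≤ ‖u x‖ * ‖x‖)]
  exact abs_real_inner_le_norm _ _

lemma norm_tangentialPart_sq (u : E3 → E3) (x : E3) :
    ‖tangentialPart u x‖ ^ 2 = ‖u x‖ ^ 2 - ‖normalPart u x‖ ^ 2 := by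
  have h : inner ℝ (u x) (normalPart u x) = ‖normalPart u x‖ ^ 2 := by
    rw [norm_normalPart_sq, normalPart, inner_smul_right, inner_smul_right]
    ring
  rw [tangentialPart, norm_sub_sq_real, h]
  ring

lemma aestronglyMeasurable_normalPart {μ : Measure E3} {u : E3 → E3}
    (hu : AEStronglyMeasurable u μ) : AEStronglyMeasurable (normalPart u) μ := by
  have hr : AEStronglyMeasurable (fun x : E3 => ‖x‖⁻¹ • x) μ :=
    (measurable_norm.inv.smul measurable_id).aestronglyMeasurable
  exact (AEStronglyMeasurable.inner (𝕜 := ℝ) hu hr).smul hr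

/-! ### The Hardy inequality and the removal of the regularization -/

section Hardy

variable {u : E3 → E3} {G : E3 → (E3 →L[ℝ] E3)} {R : ℝ} {v : ℕ → E3 → E3} {g : E3 → E3}

lemma integrable_weight_mul_norm_sq {μ : Measure E3} {p q : ℝ≥0∞} [p.HolderTriple q 1]
    (hμ : ∀ᵐ x ∂μ, ‖x‖ ≤ R) {w : E3 → ℝ} (hw : Continuous w) (hp : MemLp u p μ)
    (hq : MemLp u q μ) : Integrable (fun x => w x * ‖u x‖ ^ 2) μ := by
  have := integrable_quadForm (w₁ := fun _ => 0) continuous_const hw hμ hp hq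
  refine this.congr (Eventually.of_forall fun x => ?_)
  simp only [quadForm, real_inner_self_eq_norm_sq, zero_mul, zero_add]

lemma SmoothApprox.integrableOn_weight_mul (h : SmoothApprox u G R v g) {w : E3 → ℝ}
    (hw : Continuous w) : IntegrableOn (fun x => w x * ‖u x‖ ^ 2) (ball 0 R) :=
  integrable_weight_mul_norm_sq (p := 3 / 2) (q := 3) (ae_ball_norm_le R) hw h.memLp h.memLp_three

lemma SmoothApprox.integrable_surface (h : SmoothApprox u G R v g) :
    Integrable (fun x => ‖g x‖ ^ 2) (surfaceMeasure R) := h.memLp_trace.norm.integrable_sq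

/-- In the radial identity with `m = (|x|² + ε²)^(-1/2)` one has `3 m + k |x|² ≥ 2 m ≥ m`, while `m
|x| ≤ 1` bounds the derivative term and the boundary term. The right-hand side does not depend on
`ε`. -/
lemma SmoothApprox.integral_regPow_le (h : SmoothApprox u G R v g) {ε : ℝ} (hε : 0 < ε) :
    ∫ x in ball 0 R, regPow ε (-1 / 2) x * ‖u x‖ ^ 2
      ≤ (∫ x, ‖g x‖ ^ 2 ∂(surfaceMeasure R)) + ∫ x in ball 0 R, 2 * (‖u x‖ * ‖G x‖) := by
  set m := regPow ε (-1 / 2) with hm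
  set k : E3 → ℝ := fun x => 2 * (-1 / 2) * regPow ε (-1 / 2 - 1) x with hk
  have hmc : Continuous m := (contDiff_regPow hε _).continuous
  have hkc : Continuous k := (contDiff_regPow hε _).continuous.const_mul _
  have hm0 : ∀ x, 0 < m x := regPow_pos hε _
  have hmx : ∀ x, m x * ‖x‖ ≤ 1 := fun x => by
    by_cases hx : x = 0
    · simp [hx]
    · have h1 := regPow_le_of_nonpos (ε := ε) (b := -1 / 2) (by norm_num) hx
      rw [show (2 * (-1 / 2) : ℝ) = -1 by norm_num, Real.rpow_neg_one] at h1
      have : 0 < ‖x‖ := norm_pos_iff.2 hx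
      calc m x * ‖x‖ ≤ ‖x‖⁻¹ * ‖x‖ := by gcongr
        _ = 1 := inv_mul_cancel₀ this.ne'
  have hkey := h.integral_norm_sq_radial (contDiff_regPow hε _) hkc (hasFDerivAt_regPow hε _)
  simp only [← hm] at hkey
  have hUG : IntegrableOn (fun x => 2 * (‖u x‖ * ‖G x‖)) (ball 0 R) :=
    (h.memLp_three.norm.integrable_mul h.memLp_deriv.norm).const_mul 2
  have h1 : ∫ x in ball 0 R, m x * ‖u x‖ ^ 2
      ≤ ∫ x in ball 0 R, (3 * m x + k x * ‖x‖ ^ 2) * ‖u x‖ ^ 2 := by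
    refine integral_mono (h.integrableOn_weight_mul hmc)
      (h.integrableOn_weight_mul (by fun_prop)) fun x => ?_
    refine mul_le_mul_of_nonneg_right ?_ (by positivity)
    have h2 := regPow_sub_one_mul_le hε (-1 / 2) x
    have h3 := hm0 x
    simp only [hk]
    simp only [hm] at h3 ⊢
    linarith
  have h2 : -(∫ x in ball 0 R, 2 * m x * inner ℝ (u x) (G x x))
      ≤ ∫ x in ball 0 R, 2 * (‖u x‖ * ‖G x‖) := by
    rw [← integral_neg]
    refine integral_mono (integrable_derivForm (p := 3) (q := 3 / 2) (hmc.const_mul 2)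
      (ae_ball_norm_le R) h.memLp_three h.memLp_deriv).neg hUG fun x => ?_
    have ha : -inner ℝ (u x) (G x x) ≤ ‖u x‖ * (‖G x‖ * ‖x‖) :=
      (neg_le_abs _).trans ((abs_real_inner_le_norm _ _).trans
        (by gcongr; exact (G x).le_opNorm x))
    calc -(2 * m x * inner ℝ (u x) (G x x)) = 2 * m x * -inner ℝ (u x) (G x x) := by ring
      _ ≤ 2 * m x * (‖u x‖ * (‖G x‖ * ‖x‖)) := by
          have := hm0 x
          gcongr
      _ = (m x * ‖x‖) * (2 * (‖u x‖ * ‖G x‖)) := by ring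
      _ ≤ 1 * (2 * (‖u x‖ * ‖G x‖)) := by
          gcongr
          exact hmx x
      _ = _ := one_mul _
  have h3 : R * ∫ x, m x * ‖g x‖ ^ 2 ∂(surfaceMeasure R) ≤ ∫ x, ‖g x‖ ^ 2 ∂(surfaceMeasure R) := by
    rw [← integral_const_mul]
    refine integral_mono_ae ((integrable_weight_mul_norm_sq (p := 2) (q := 2)
      (ae_surface_norm_le h.pos) hmc h.memLp_trace h.memLp_trace).const_mul R)
      h.integrable_surface ?_
    filter_upwards [ae_surfaceMeasure_norm_eq h.pos] with x hx
    have := hmx x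
    rw [hx] at this
    calc R * (m x * ‖g x‖ ^ 2) = (m x * R) * ‖g x‖ ^ 2 := by ring
      _ ≤ 1 * ‖g x‖ ^ 2 := by gcongr
      _ = _ := one_mul _
  linarith

/-- A Hardy inequality: `|u|² / |x|` is integrable. -/
theorem SmoothApprox.integrableOn_norm_sq_div (h : SmoothApprox u G R v g) :
    IntegrableOn (fun x => ‖u x‖ ^ 2 / ‖x‖) (ball 0 R) := by
  set M := (∫ x, ‖g x‖ ^ 2 ∂(surfaceMeasure R)) + ∫ x in ball 0 R, 2 * (‖u x‖ * ‖G x‖)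
  set ε : ℕ → ℝ := fun n => 1 / ((n : ℝ) + 1) with hεdef
  have hε : ∀ n, 0 < ε n := fun n => by positivity
  have hε0 : Tendsto ε atTop (𝓝[>] 0) :=
    tendsto_nhdsWithin_iff.2 ⟨tendsto_one_div_add_atTop_nhds_zero_nat, Eventually.of_forall hε⟩
  have hint : ∀ n, IntegrableOn (fun x => regPow (ε n) (-1 / 2) x * ‖u x‖ ^ 2) (ball 0 R) :=
    fun n => h.integrableOn_weight_mul (contDiff_regPow (hε n) _).continuous
  have hmeas : AEStronglyMeasurable (fun x => ‖u x‖ ^ 2 / ‖x‖) (volume.restrict (ball 0 R)) :=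
    ((h.memLp.1.norm.aemeasurable.pow_const 2).div measurable_norm.aemeasurable).aestronglyMeasurable
  refine ⟨hmeas, ?_⟩
  rw [hasFiniteIntegral_iff_ofReal (Eventually.of_forall fun x => by positivity)]
  -- Fatou's lemma along `ε n → 0`, with the uniform bound `M`.
  have hlim : ∀ᵐ x ∂(volume.restrict (ball (0 : E3) R)), ENNReal.ofReal (‖u x‖ ^ 2 / ‖x‖)
      = liminf (fun n => ENNReal.ofReal (regPow (ε n) (-1 / 2) x * ‖u x‖ ^ 2)) atTop := by
    filter_upwards [ae_restrict_of_ae ae_ne_zero_E3] with x hx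
    refine (Tendsto.liminf_eq ?_).symm
    refine ENNReal.tendsto_ofReal ?_
    have := ((tendsto_regPow (-1 / 2) hx).comp hε0).mul_const (‖u x‖ ^ 2)
    rw [show (2 * (-1 / 2) : ℝ) = -1 by norm_num, Real.rpow_neg_one, inv_mul_eq_div] at this
    exact this
  calc ∫⁻ x in ball 0 R, ENNReal.ofReal (‖u x‖ ^ 2 / ‖x‖)
      = ∫⁻ x in ball 0 R, liminf (fun n => ENNReal.ofReal (regPow (ε n) (-1 / 2) x * ‖u x‖ ^ 2))
          atTop := lintegral_congr_ae hlim
    _ ≤ liminf (fun n => ∫⁻ x in ball 0 R, ENNReal.ofReal (regPow (ε n) (-1 / 2) x * ‖u x‖ ^ 2))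
          atTop := lintegral_liminf_le' fun n => (hint n).aemeasurable.ennreal_ofReal
    _ ≤ liminf (fun _ : ℕ => ENNReal.ofReal M) atTop := by
        refine liminf_le_liminf (Eventually.of_forall fun n => ?_)
        rw [← ofReal_integral_eq_lintegral_ofReal (hint n) (Eventually.of_forall fun x =>
          mul_nonneg (regPow_pos (hε n) _ x).le (by positivity))]
        exact ENNReal.ofReal_le_ofReal (h.integral_regPow_le (hε n))
    _ = ENNReal.ofReal M := liminf_const _
    _ < ⊤ := ENNReal.ofReal_lt_top

/-- Since `1 - α ≥ 0`, the weight `|x|^(-α) = |x|^(1 - α)/|x|` is at most `R^(1 - α)/|x|` on the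
ball, and the Hardy inequality applies. -/
lemma SmoothApprox.integrableOn_norm_sq_div_rpow (h : SmoothApprox u G R v g) {α : ℝ}
    (hα : α ≤ 1) : IntegrableOn (fun x => ‖u x‖ ^ 2 / ‖x‖ ^ α) (ball 0 R) := by
  have hm : AEStronglyMeasurable (fun x => ‖u x‖ ^ 2 / ‖x‖ ^ α) (volume.restrict (ball 0 R)) :=
    ((h.memLp.1.norm.aemeasurable.pow_const 2).div
      (measurable_norm.pow_const α).aemeasurable).aestronglyMeasurable
  refine Integrable.mono' (h.integrableOn_norm_sq_div.const_mul (R ^ (1 - α))) hm ?_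
  filter_upwards [ae_restrict_of_ae ae_ne_zero_E3, ae_ball_norm_le R] with x hx hxR
  have hx0 : 0 < ‖x‖ := norm_pos_iff.2 hx
  rw [Real.norm_of_nonneg (by positivity)]
  have h1 : ‖x‖ ^ (1 - α) ≤ R ^ (1 - α) := Real.rpow_le_rpow hx0.le hxR (by linarith)
  have h2 : ‖u x‖ ^ 2 / ‖x‖ ^ α = ‖x‖ ^ (1 - α) * (‖u x‖ ^ 2 / ‖x‖) := by
    rw [Real.rpow_sub hx0, Real.rpow_one]
    field_simp
  rw [h2]
  gcongr

lemma SmoothApprox.integrableOn_normalPart_sq_div_rpow (h : SmoothApprox u G R v g) {α : ℝ}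
    (hα : α ≤ 1) : IntegrableOn (fun x => ‖normalPart u x‖ ^ 2 / ‖x‖ ^ α) (ball 0 R) := by
  refine Integrable.mono' (h.integrableOn_norm_sq_div_rpow hα) ?_ ?_
  · exact (((aestronglyMeasurable_normalPart h.memLp.1).norm.aemeasurable.pow_const 2).div
      (measurable_norm.pow_const α).aemeasurable).aestronglyMeasurable
  · refine Eventually.of_forall fun x => ?_
    rw [Real.norm_of_nonneg (by positivity)]
    gcongr
    exact norm_normalPart_le u x

/-- The regularized bulk integrals converge. -/
lemma SmoothApprox.tendsto_integral_regPow (h : SmoothApprox u G R v g) {α : ℝ} (hα : α ≤ 1) :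
    Tendsto (fun ε => ∫ x in ball 0 R,
        quadForm (fun x => 2 * (-α / 2) * regPow ε (-α / 2 - 1) x)
          (fun x => -((2 * (-α / 2) * regPow ε (-α / 2 - 1) x * ‖x‖ ^ 2
            + regPow ε (-α / 2) x) / 2)) x (u x) (u x)) (𝓝[>] 0)
      (𝓝 (∫ x in ball 0 R, ((α - 1) / 2 * (‖u x‖ ^ 2 / ‖x‖ ^ α)
        - α * (‖normalPart u x‖ ^ 2 / ‖x‖ ^ α)))) := by
  have hU := h.integrableOn_norm_sq_div_rpow hα
  have hU0 : IntegrableOn (fun x => ‖u x‖ ^ 2) (ball 0 R) := by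
    simpa using h.integrableOn_weight_mul (w := fun _ => 1) continuous_const
  have hsmall : ∀ᶠ ε in 𝓝[>] (0 : ℝ), 0 < ε ∧ ε ≤ 1 := by
    filter_upwards [Ioc_mem_nhdsGT (zero_lt_one' ℝ)] with ε hε using hε
  -- For `α ≥ 0` the regularized weight is at most `|x|^(-α)`; for `α ≤ 0` and `ε ≤ 1` it is at most
  -- `D`. The sum covers both signs.
  set D := (R ^ 2 + 1) ^ (-α / 2) with hD
  have hD0 : 0 ≤ D := by positivity
  -- The factor `2 |α| + 1` adds `|α|` from the term with `(u · x)²` and `|α| + 1` from the term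
  -- with `|u|²`.
  refine tendsto_integral_filter_of_dominated_convergence
    (fun x => (2 * |α| + 1) * (‖u x‖ ^ 2 / ‖x‖ ^ α + D * ‖u x‖ ^ 2)) ?_ ?_ ?_ ?_
  · filter_upwards [hsmall] with ε hε
    have c1 := (contDiff_regPow hε.1 (-α / 2 - 1)).continuous
    have c2 := (contDiff_regPow hε.1 (-α / 2)).continuous
    exact (integrable_quadForm (p := 3 / 2) (q := 3) (by fun_prop) (by fun_prop)
      (ae_ball_norm_le R) h.memLp h.memLp_three).1
  · filter_upwards [hsmall] with ε hε
    filter_upwards [ae_restrict_of_ae ae_ne_zero_E3, ae_ball_norm_le R] with x hx hxR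
    have hx0 : 0 < ‖x‖ := norm_pos_iff.2 hx
    set m := regPow ε (-α / 2) x with hm
    set k := regPow ε (-α / 2 - 1) x with hk
    have hk0 : 0 < k := regPow_pos hε.1 _ x
    have hm0 : 0 < m := regPow_pos hε.1 _ x
    have hkm : k * ‖x‖ ^ 2 ≤ m := regPow_sub_one_mul_le hε.1 _ x
    have hmb : m ≤ (‖x‖ ^ α)⁻¹ + D := by
      rcases le_total 0 α with h0 | h0
      · have h1 := regPow_le_of_nonpos (ε := ε) (b := -α / 2) (by linarith) hx
        rw [show 2 * (-α / 2) = -α by ring, Real.rpow_neg hx0.le] at h1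
        linarith
      · have h1 := regPow_le_of_nonneg hε.1.le hε.2 (b := -α / 2) (by linarith) hxR
        have : 0 ≤ (‖x‖ ^ α)⁻¹ := by positivity
        linarith
    have hq : inner ℝ (u x) x ^ 2 ≤ (‖u x‖ * ‖x‖) ^ 2 := by
      rw [sq_le_sq, abs_of_nonneg (by positivity : 0 ≤ ‖u x‖ * ‖x‖)]
      exact abs_real_inner_le_norm _ _
    have e1 : |2 * (-α / 2) * k * (inner ℝ (u x) x * inner ℝ (u x) x)|
        ≤ |α| * (m * ‖u x‖ ^ 2) := by
      rw [show 2 * (-α / 2) * k * (inner ℝ (u x) x * inner ℝ (u x) x)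
        = -α * (k * inner ℝ (u x) x ^ 2) by ring, abs_mul, abs_neg,
        abs_of_nonneg (by positivity : 0 ≤ k * inner ℝ (u x) x ^ 2)]
      refine mul_le_mul_of_nonneg_left ?_ (abs_nonneg _)
      calc k * inner ℝ (u x) x ^ 2 ≤ k * (‖u x‖ * ‖x‖) ^ 2 := by gcongr
        _ = (k * ‖x‖ ^ 2) * ‖u x‖ ^ 2 := by ring
        _ ≤ m * ‖u x‖ ^ 2 := by gcongr
    have e2 : |-((2 * (-α / 2) * k * ‖x‖ ^ 2 + m) / 2)| ≤ (|α| + 1) * m := by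
      rw [abs_neg, abs_div, abs_two, div_le_iff₀ two_pos]
      have e3 : |2 * (-α / 2) * k * ‖x‖ ^ 2| ≤ |α| * m := by
        rw [show 2 * (-α / 2) * k * ‖x‖ ^ 2 = -α * (k * ‖x‖ ^ 2) by ring, abs_mul, abs_neg,
          abs_of_nonneg (by positivity : 0 ≤ k * ‖x‖ ^ 2)]
        gcongr
      have e4 := abs_add_le (2 * (-α / 2) * k * ‖x‖ ^ 2) m
      rw [abs_of_pos hm0] at e4
      nlinarith [abs_nonneg α]
    rw [Real.norm_eq_abs, quadForm, real_inner_self_eq_norm_sq]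
    refine (abs_add_le _ _).trans ?_
    rw [abs_mul (-((2 * (-α / 2) * k * ‖x‖ ^ 2 + m) / 2)),
      abs_of_nonneg (by positivity : 0 ≤ ‖u x‖ ^ 2)]
    calc _ ≤ |α| * (m * ‖u x‖ ^ 2) + (|α| + 1) * m * ‖u x‖ ^ 2 := by gcongr
      _ = (2 * |α| + 1) * (m * ‖u x‖ ^ 2) := by ring
      _ ≤ (2 * |α| + 1) * (((‖x‖ ^ α)⁻¹ + D) * ‖u x‖ ^ 2) := by gcongr
      _ = _ := by rw [div_eq_mul_inv]; ring
  · exact (hU.add (hU0.const_mul D)).const_mul _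
  · filter_upwards [ae_restrict_of_ae ae_ne_zero_E3] with x hx
    have hx0 : 0 < ‖x‖ := norm_pos_iff.2 hx
    have t1 := tendsto_regPow (-α / 2) hx
    have t2 := tendsto_regPow (-α / 2 - 1) hx
    have t3 := ((t2.const_mul (2 * (-α / 2))).mul_const
      (inner ℝ (u x) x * inner ℝ (u x) x)).add
      (((((t2.const_mul (2 * (-α / 2))).mul_const (‖x‖ ^ 2)).add t1).div_const 2).neg.mul_const
        (inner ℝ (u x) (u x)))
    -- Convergence is an inequality of filters, so an equality of limit points is all that remains.
    refine (t3.congr fun _ => rfl).trans (le_of_eq (congrArg 𝓝 ?_))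
    rw [norm_normalPart_sq, real_inner_self_eq_norm_sq,
      show 2 * (-α / 2) = -α by ring, show 2 * (-α / 2 - 1) = -α - 2 by ring,
      Real.rpow_sub hx0, Real.rpow_neg hx0.le, Real.rpow_two]
    have := Real.rpow_pos_of_pos hx0 α
    field_simp
    ring

/-- The weighted identity in terms of the boundary integral of `|g_N|² - |g|² / 2`. -/
theorem SmoothApprox.weighted_identity (h : SmoothApprox u G R v g)
    (hG : ∀ᵐ x, stressDiv x (G x) (u x) = 0) {α : ℝ} (hα : α ≤ 1) :
    (α - 1) / 2 * (∫ x in ball 0 R, ‖u x‖ ^ 2 / ‖x‖ ^ α)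
        - α * (∫ x in ball 0 R, ‖normalPart u x‖ ^ 2 / ‖x‖ ^ α)
      = R / R ^ α * ∫ x, (‖normalPart g x‖ ^ 2 - ‖g x‖ ^ 2 / 2) ∂(surfaceMeasure R) := by
  have hR := h.pos
  set J := ∫ x, (‖normalPart g x‖ ^ 2 - ‖g x‖ ^ 2 / 2) ∂(surfaceMeasure R) with hJ
  -- On the sphere the weight is constant and `(g · x)² = R² |g_N|²`, so every exponent leads to the
  -- same boundary integral `J`.
  have hs : ∀ ε : ℝ, 0 < ε → ∫ x, quadForm (regPow ε (-α / 2))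
      (fun x => -(regPow ε (-α / 2) x * (‖x‖ ^ 2 / 2))) x (g x) (g x) ∂(surfaceMeasure R)
      = (R ^ 2 + ε ^ 2) ^ (-α / 2) * (R ^ 2 * J) := by
    intro ε hε
    rw [hJ, ← integral_const_mul, ← integral_const_mul]
    refine integral_congr_ae ?_
    filter_upwards [ae_surfaceMeasure_norm_eq hR] with x hx
    simp only [quadForm, regPow, norm_normalPart_sq, real_inner_self_eq_norm_sq, hx]
    field_simp
    ring
  have t1 := (h.tendsto_integral_regPow hα).const_mul R
  have hL : Tendsto (fun ε : ℝ => (R ^ 2 + ε ^ 2) ^ (-α / 2) * (R ^ 2 * J)) (𝓝[>] 0)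
      (𝓝 ((R ^ α)⁻¹ * (R ^ 2 * J))) := by
    have h1 : ContinuousAt (fun ε : ℝ => (R ^ 2 + ε ^ 2) ^ (-α / 2)) 0 :=
      ContinuousAt.rpow_const (by fun_prop) (Or.inl (by simpa using hR.ne'))
    have h2 := h1.tendsto.mono_left (nhdsWithin_le_nhds (s := Set.Ioi (0 : ℝ)))
    have h3 : (R ^ 2 + (0 : ℝ) ^ 2) ^ (-α / 2) = (R ^ α)⁻¹ := by
      rw [zero_pow two_ne_zero, add_zero, ← Real.rpow_two, ← Real.rpow_mul hR.le, show 2 * (-α / 2) = -α by ring,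
        Real.rpow_neg hR.le]
    rw [h3] at h2
    exact h2.mul_const _
  have heq : ∀ᶠ ε in 𝓝[>] (0 : ℝ), R * ∫ x in ball 0 R,
        quadForm (fun x => 2 * (-α / 2) * regPow ε (-α / 2 - 1) x)
          (fun x => -((2 * (-α / 2) * regPow ε (-α / 2 - 1) x * ‖x‖ ^ 2
            + regPow ε (-α / 2) x) / 2)) x (u x) (u x)
      = (R ^ 2 + ε ^ 2) ^ (-α / 2) * (R ^ 2 * J) := by
    filter_upwards [self_mem_nhdsWithin] with ε hε
    rw [← hs ε hε]
    exact h.integral_stress (contDiff_regPow hε _)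
      ((contDiff_regPow hε _).continuous.const_mul _) (hasFDerivAt_regPow hε _) hG
  have hfin := tendsto_nhds_unique (t1.congr' heq) hL
  rw [integral_sub ((h.integrableOn_norm_sq_div_rpow hα).const_mul _)
    ((h.integrableOn_normalPart_sq_div_rpow hα).const_mul _), integral_const_mul,
    integral_const_mul] at hfin
  have hRα : R ^ α ≠ 0 := (Real.rpow_pos_of_pos hR α).ne'
  field_simp at hfin ⊢
  linarith

end Hardy

/-! ### Uniqueness of the trace -/

lemma clm_ext_e {A B : E3 →L[ℝ] E3} (h : ∀ i, A (e i) = B (e i)) : A = B := by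
  have key : ∀ (A : E3 →L[ℝ] E3) (y : E3) j, A y j = ∑ i, A (e i) j * y i := fun A y j =>
    (sum_apply_e_mul ((EuclideanSpace.proj j : E3 →L[ℝ] ℝ).comp A) y).symm
  ext y j
  rw [key A, key B]
  simp_rw [h]

/-- The fundamental lemma of the calculus of variations, applied to each partial derivative. It is
needed because `IsSphereTrace` brings its own weak derivative. -/
lemma HasWeakDeriv.ae_eq {u : E3 → E3} {G G' : E3 → (E3 →L[ℝ] E3)} (h : HasWeakDeriv u G)
    (h' : HasWeakDeriv u G') : G =ᵐ[volume] G' := by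
  have happ : ∀ {H : E3 → (E3 →L[ℝ] E3)}, HasWeakDeriv u H → ∀ i,
      LocallyIntegrable fun x => H x (e i) := fun hH i x =>
    (hH.locallyIntegrable_deriv x).imp fun s hs => ⟨hs.1, hs.2.apply_continuousLinearMap (e i)⟩
  have hi : ∀ i, ∀ᵐ x, G x (e i) - G' x (e i) = 0 := by
    intro i
    refine ae_eq_zero_of_integral_contDiff_smul_eq_zero ((happ h i).sub (happ h' i)) ?_
    intro φ hφ hφc
    have i1 := (happ h i).integrable_smul_left_of_hasCompactSupport hφ.continuous hφc
    have i2 := (happ h' i).integrable_smul_left_of_hasCompactSupport hφ.continuous hφc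
    simp_rw [smul_sub]
    rw [integral_sub i1 i2, sub_eq_zero]
    have e1 := h.integral_eq φ hφ hφc (e i)
    have e2 := h'.integral_eq φ hφ hφc (e i)
    exact neg_injective (e1.symm.trans e2)
  filter_upwards [ae_all_iff.2 hi] with x hx
  exact clm_ext_e fun i => sub_eq_zero.1 (hx i)

lemma tendsto_eLpNorm_of_exponent_le {X F : Type*} [MeasurableSpace X] {μ : Measure X}
    [IsFiniteMeasure μ] [NormedAddCommGroup F] {f : ℕ → X → F} {p q : ℝ≥0∞} (hp : p ≠ 0)
    (hpq : p ≤ q) (hf : ∀ n, AEStronglyMeasurable (f n) μ)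
    (h : Tendsto (fun n => eLpNorm (f n) q μ) atTop (𝓝 0)) :
    Tendsto (fun n => eLpNorm (f n) p μ) atTop (𝓝 0) := by
  refine tendsto_eLpNorm_of_le
    (fun n => eLpNorm_le_eLpNorm_mul_rpow_measure_univ hpq (hf n)) ?_
  have hfin : μ Set.univ ^ (1 / p.toReal - 1 / q.toReal) ≠ ⊤ := by
    by_cases hq : q = ⊤
    · subst hq
      simp only [ENNReal.toReal_top, div_zero, sub_zero]
      exact ENNReal.rpow_ne_top_of_nonneg (by positivity) (measure_ne_top _ _)
    · refine ENNReal.rpow_ne_top_of_nonneg (sub_nonneg.2 ?_) (measure_ne_top _ _)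
      have hp' : p ≠ ⊤ := (hpq.trans_lt (lt_top_iff_ne_top.2 hq)).ne
      exact one_div_le_one_div_of_le (ENNReal.toReal_pos hp hp') (ENNReal.toReal_mono hq hpq)
  simpa using ENNReal.Tendsto.mul_const h (Or.inr hfin)

lemma three_halves_le_two : (3 / 2 : ℝ≥0∞) ≤ 2 := by
  rw [← three_halves_eq_coe, ← ENNReal.coe_ofNat, ENNReal.coe_le_coe, ← NNReal.coe_le_coe]
  norm_num

lemma eLpNorm_one_eq_ofReal {X F : Type*} [MeasurableSpace X] {μ : Measure X}
    [NormedAddCommGroup F] {f : X → F} (hf : MemLp f 1 μ) :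
    eLpNorm f 1 μ = ENNReal.ofReal (∫ x, ‖f x‖ ∂μ) := by
  rw [eLpNorm_one_eq_lintegral_enorm,
    ofReal_integral_norm_eq_lintegral_enorm (memLp_one_iff_integrable.1 hf)]

/-- Continuity of the trace from `W^{1,1}` of the ball to `L^1` of the sphere. -/
lemma eLpNorm_one_surface_le {v : E3 → E3} (hv : ContDiff ℝ 1 v) {R : ℝ} (hR : 0 < R) :
    eLpNorm v 1 (surfaceMeasure R) ≤ ENNReal.ofReal R⁻¹ *
      (3 * eLpNorm v 1 (volume.restrict (ball 0 R))
        + ENNReal.ofReal R * eLpNorm (fderiv ℝ v) 1 (volume.restrict (ball 0 R))) := by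
  have hvm := hv.continuous.memLp_ball 1 R
  have hdm := (hv.continuous_fderiv one_ne_zero).memLp_ball 1 R
  have h := integral_norm_surface_le hv hR
  rw [integral_add ((memLp_one_iff_integrable.1 hvm).norm.const_mul 3)
    ((memLp_one_iff_integrable.1 hdm).norm.const_mul R), integral_const_mul,
    integral_const_mul] at h
  rw [eLpNorm_one_eq_ofReal (hv.continuous.memLp_surface 1 hR), eLpNorm_one_eq_ofReal hvm,
    eLpNorm_one_eq_ofReal hdm, ← ENNReal.ofReal_ofNat 3,
    ← ENNReal.ofReal_mul (by norm_num), ← ENNReal.ofReal_mul hR.le,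
    ← ENNReal.ofReal_add (by positivity) (by positivity), ← ENNReal.ofReal_mul (by positivity)]
  refine ENNReal.ofReal_le_ofReal ?_
  rw [inv_mul_eq_div, le_div_iff₀ hR, mul_comm]
  exact h

section Trace

variable {u : E3 → E3} {G : E3 → (E3 →L[ℝ] E3)} {R : ℝ} {v : ℕ → E3 → E3} {g : E3 → E3}

lemma SmoothApprox.isSphereTrace (h : SmoothApprox u G R v g) (hG : HasWeakDeriv u G) :
    IsSphereTrace (3 / 2) u R g :=
  ⟨h.memLp_trace.mono_exponent three_halves_le_two, G, hG, v, h.contDiff, h.tendsto,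
    h.tendsto_deriv, tendsto_eLpNorm_of_exponent_le (zero_lt_one.trans_le one_le_three_halves).ne'
      three_halves_le_two
      (fun n => (h.contDiff n).continuous.aestronglyMeasurable.sub h.memLp_trace.1)
      h.tendsto_trace⟩

/-- The differences of the two approximating sequences tend to zero in `W^{1,1}` of the ball, hence
in `L¹` of the sphere, so both sequences have the same limit there. Working in `L¹` suffices, since
the measures are finite. -/
lemma SmoothApprox.ae_eq_of_isSphereTrace (h : SmoothApprox u G R v g) (hG : HasWeakDeriv u G)
    {g' : E3 → E3} (hg' : IsSphereTrace (3 / 2) u R g') : g' =ᵐ[surfaceMeasure R] g := by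
  obtain ⟨hg'm, G', hG', w, hw, hw1, hw2, hw3⟩ := hg'
  have hR := h.pos
  have hw' : ∀ n, ContDiff ℝ 1 (w n) := fun n => (hw n).of_le (by norm_cast)
  have hwc : ∀ n, Continuous (w n) := fun n => (hw n).continuous
  have hvc : ∀ n, Continuous (v n) := fun n => (h.contDiff n).continuous
  have hwd : ∀ n, Continuous (fderiv ℝ (w n)) := fun n => (hw' n).continuous_fderiv one_ne_zero
  have hvd : ∀ n, Continuous (fderiv ℝ (v n)) := fun n =>
    (h.contDiff_one n).continuous_fderiv one_ne_zero
  have hGG : G' =ᵐ[volume.restrict (ball 0 R)] G := ae_restrict_of_ae (hG'.ae_eq hG)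
  have d1 : Tendsto (fun n => eLpNorm (w n - v n) 1 (volume.restrict (ball 0 R)))
      atTop (𝓝 0) := by
    refine tendsto_eLpNorm_of_exponent_le one_ne_zero one_le_three_halves
      (fun n => ((hwc n).sub (hvc n)).aestronglyMeasurable) ?_
    refine tendsto_eLpNorm_of_le (fun n => ?_) (by simpa using hw1.add h.tendsto)
    have : w n - v n = (w n - u) - (v n - u) := by abel
    rw [this]
    exact eLpNorm_sub_le ((hwc n).aestronglyMeasurable.sub h.memLp.1)
      ((hvc n).aestronglyMeasurable.sub h.memLp.1) one_le_three_halves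
  have d2 : Tendsto (fun n => eLpNorm (fderiv ℝ (w n - v n)) 1 (volume.restrict (ball 0 R)))
      atTop (𝓝 0) := by
    have hfd : ∀ n, fderiv ℝ (w n - v n) = fderiv ℝ (w n) - fderiv ℝ (v n) := fun n => by
      funext x
      exact fderiv_sub ((hw' n).differentiable one_ne_zero x)
        ((h.contDiff_one n).differentiable one_ne_zero x)
    simp_rw [hfd]
    refine tendsto_eLpNorm_of_exponent_le one_ne_zero one_le_three_halves
      (fun n => ((hwd n).sub (hvd n)).aestronglyMeasurable) ?_
    have hw2' : Tendsto (fun n => eLpNorm (fderiv ℝ (w n) - G) (3 / 2)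
        (volume.restrict (ball 0 R))) atTop (𝓝 0) := by
      refine hw2.congr fun n => eLpNorm_congr_ae ?_
      filter_upwards [hGG] with x hx
      simp only [Pi.sub_apply, hx]
    refine tendsto_eLpNorm_of_le (fun n => ?_) (by simpa using hw2'.add h.tendsto_deriv)
    have : fderiv ℝ (w n) - fderiv ℝ (v n) = (fderiv ℝ (w n) - G) - (fderiv ℝ (v n) - G) := by
      abel
    rw [this]
    exact eLpNorm_sub_le ((hwd n).aestronglyMeasurable.sub h.memLp_deriv.1)
      ((hvd n).aestronglyMeasurable.sub h.memLp_deriv.1) one_le_three_halves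
  have d3 : Tendsto (fun n => eLpNorm (w n - v n) 1 (surfaceMeasure R)) atTop (𝓝 0) := by
    refine tendsto_eLpNorm_of_le
      (fun n => eLpNorm_one_surface_le (v := w n - v n) ((hw' n).sub (h.contDiff_one n)) hR) ?_
    have a1 := ENNReal.Tendsto.const_mul (a := 3) d1 (Or.inr (by norm_num))
    have a2 := ENNReal.Tendsto.const_mul (a := ENNReal.ofReal R) d2 (Or.inr ENNReal.ofReal_ne_top)
    simpa using ENNReal.Tendsto.const_mul (a := ENNReal.ofReal R⁻¹) (a1.add a2)
      (Or.inr ENNReal.ofReal_ne_top)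
  have d4 : Tendsto (fun n => eLpNorm (v n - g) 1 (surfaceMeasure R)) atTop (𝓝 0) :=
    tendsto_eLpNorm_of_exponent_le one_ne_zero (by norm_num)
      (fun n => (hvc n).aestronglyMeasurable.sub h.memLp_trace.1) h.tendsto_trace
  have d5 : Tendsto (fun n => eLpNorm (w n - g) 1 (surfaceMeasure R)) atTop (𝓝 0) := by
    refine tendsto_eLpNorm_of_le (fun n => ?_) (by simpa using d3.add d4)
    have : w n - g = (w n - v n) + (v n - g) := by abel
    rw [this]
    exact eLpNorm_add_le ((hwc n).aestronglyMeasurable.sub (hvc n).aestronglyMeasurable)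
      ((hvc n).aestronglyMeasurable.sub h.memLp_trace.1) le_rfl
  exact ae_eq_of_tendsto_eLpNorm (zero_lt_one.trans_le one_le_three_halves).ne' one_ne_zero
    (fun n => (hwc n).aestronglyMeasurable) hg'm.1 h.memLp_trace.1 hw3 d5

lemma SmoothApprox.congr_trace (h : SmoothApprox u G R v g) {g' : E3 → E3}
    (hg' : g' =ᵐ[surfaceMeasure R] g) : SmoothApprox u G R v g' where
  pos := h.pos
  contDiff := h.contDiff
  memLp := h.memLp
  memLp_three := h.memLp_three
  memLp_deriv := h.memLp_deriv
  memLp_trace := h.memLp_trace.ae_eq hg'.symm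
  tendsto := h.tendsto
  tendsto_three := h.tendsto_three
  tendsto_deriv := h.tendsto_deriv
  tendsto_trace := h.tendsto_trace.congr fun _ =>
    eLpNorm_congr_ae ((ae_eq_refl _).sub hg'.symm)

/-! ### Boundary integrals and the special weights -/

lemma integral_surface_div_rpow {R : ℝ} (hR : 0 < R) (f : E3 → ℝ) (α : ℝ) :
    ∫ x, f x / ‖x‖ ^ α ∂(surfaceMeasure R) = (∫ x, f x ∂(surfaceMeasure R)) / R ^ α := by
  rw [← integral_div]
  refine integral_congr_ae ?_
  filter_upwards [ae_surfaceMeasure_norm_eq hR] with x hx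
  rw [hx]

lemma SmoothApprox.integrable_surface_normalPart (h : SmoothApprox u G R v g) :
    Integrable (fun x => ‖normalPart g x‖ ^ 2) (surfaceMeasure R) := by
  refine (h.memLp_trace.of_le (aestronglyMeasurable_normalPart h.memLp_trace.1)
    (Eventually.of_forall fun x => norm_normalPart_le g x)).norm.integrable_sq

theorem SmoothApprox.power_weight_identity (h : SmoothApprox u G R v g)
    (hG : ∀ᵐ x, stressDiv x (G x) (u x) = 0) {α : ℝ} (hα : α ≤ 1) :
    (α - 1) / 2 * (∫ x in ball 0 R, ‖u x‖ ^ 2 / ‖x‖ ^ α)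
        + R / 2 * (∫ x, ‖g x‖ ^ 2 / ‖x‖ ^ α ∂(surfaceMeasure R))
      = α * (∫ x in ball 0 R, ‖normalPart u x‖ ^ 2 / ‖x‖ ^ α)
        + R * (∫ x, ‖normalPart g x‖ ^ 2 / ‖x‖ ^ α ∂(surfaceMeasure R)) := by
  have hid := h.weighted_identity hG hα
  rw [integral_sub h.integrable_surface_normalPart (h.integrable_surface.div_const 2),
    integral_div] at hid
  rw [integral_surface_div_rpow h.pos, integral_surface_div_rpow h.pos]
  have hR := (Real.rpow_pos_of_pos h.pos α).ne'
  linear_combination hid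

/-- Every quantity is `-J`. The exponent `1` removes the integral of `|u|²` and gives the one of
`|u_N|²/|x|`; the exponent `0` removes the normal part and gives the one of `|u|²`; for `-1` the two
integrals combine into that of `|x| |u_T|²`. -/
theorem SmoothApprox.equal_weighted_integrals (h : SmoothApprox u G R v g)
    (hG : ∀ᵐ x, stressDiv x (G x) (u x) = 0) :
    IntegrableOn (fun x => ‖x‖ * ‖tangentialPart u x‖ ^ 2) (ball 0 R) ∧
      IntegrableOn (fun x => ‖u x‖ ^ 2) (ball 0 R) ∧
      (∫ x in ball 0 R, ‖normalPart u x‖ ^ 2 / ‖x‖)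
        = 1 / R ^ 2 * (∫ x in ball 0 R, ‖x‖ * ‖tangentialPart u x‖ ^ 2) ∧
      1 / R ^ 2 * (∫ x in ball 0 R, ‖x‖ * ‖tangentialPart u x‖ ^ 2)
        = 1 / (2 * R) * (∫ x in ball 0 R, ‖u x‖ ^ 2) ∧
      1 / (2 * R) * (∫ x in ball 0 R, ‖u x‖ ^ 2)
        = 1 / 2 * (∫ x, (‖tangentialPart g x‖ ^ 2 - ‖normalPart g x‖ ^ 2)
            ∂(surfaceMeasure R)) := by
  have hR := h.pos
  set J := ∫ x, (‖normalPart g x‖ ^ 2 - ‖g x‖ ^ 2 / 2) ∂(surfaceMeasure R) with hJ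
  have h1 := h.weighted_identity hG (le_refl 1)
  have h0 := h.weighted_identity hG zero_le_one
  have hm := h.weighted_identity hG (α := -1) (by norm_num)
  have iu := h.integrableOn_norm_sq_div_rpow (α := -1) (by norm_num)
  have iN := h.integrableOn_normalPart_sq_div_rpow (α := -1) (by norm_num)
  have iu0 := h.integrableOn_norm_sq_div_rpow zero_le_one
  simp only [Real.rpow_one, Real.rpow_zero, div_one] at h1 h0 iu0
  have hpw : ∀ x : E3, ‖x‖ * ‖tangentialPart u x‖ ^ 2
      = ‖u x‖ ^ 2 / ‖x‖ ^ (-1 : ℝ) - ‖normalPart u x‖ ^ 2 / ‖x‖ ^ (-1 : ℝ) := fun x => by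
    rw [norm_tangentialPart_sq, Real.rpow_neg_one, div_inv_eq_mul, div_inv_eq_mul]
    ring
  have hT : ∫ x in ball 0 R, ‖x‖ * ‖tangentialPart u x‖ ^ 2
      = (∫ x in ball 0 R, ‖u x‖ ^ 2 / ‖x‖ ^ (-1 : ℝ))
        - ∫ x in ball 0 R, ‖normalPart u x‖ ^ 2 / ‖x‖ ^ (-1 : ℝ) := by
    rw [← integral_sub iu iN]
    simp_rw [hpw]
  have hS : ∫ x, (‖tangentialPart g x‖ ^ 2 - ‖normalPart g x‖ ^ 2) ∂(surfaceMeasure R)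
      = -2 * J := by
    rw [hJ, ← integral_const_mul]
    refine integral_congr_ae (Eventually.of_forall fun x => ?_)
    simp only [norm_tangentialPart_sq]
    ring
  rw [hS]
  rw [Real.rpow_neg_one, div_inv_eq_mul] at hm
  have e1 : ∫ x in ball 0 R, ‖normalPart u x‖ ^ 2 / ‖x‖ = -J := by
    rw [div_self hR.ne'] at h1
    linarith
  have e2 : ∫ x in ball 0 R, ‖x‖ * ‖tangentialPart u x‖ ^ 2 = -(R ^ 2 * J) := by
    rw [hT]
    linarith
  have e3 : ∫ x in ball 0 R, ‖u x‖ ^ 2 = -(2 * R * J) := by linarith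
  refine ⟨?_, iu0, ?_, ?_, ?_⟩
  · simp_rw [hpw]
    exact iu.sub iN
  · rw [e1, e2]; field_simp
  · rw [e2, e3]; field_simp
  · rw [e3]; field_simp

end Trace

end Beltrami

end

theorem lemma2 (α : ℝ) (hα : α ≤ 1) (u : E3 → E3) (hu : Beltrami.IsWeakBeltramiFlow u)
    (R : ℝ) (hR : 0 < R) :
    -- the boundary values of `u` on the sphere exist, as a trace
    (∃ g : E3 → E3, Beltrami.IsSphereTrace (3 / 2) u R g) ∧
    -- they are square integrable, and the identities hold for them
    ∀ g : E3 → E3, Beltrami.IsSphereTrace (3 / 2) u R g →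
      MemLp g 2 (Beltrami.surfaceMeasure R) ∧
      IntegrableOn (fun x => ‖u x‖ ^ 2 / ‖x‖ ^ α) (ball 0 R) ∧
      IntegrableOn (fun x => ‖Beltrami.normalPart u x‖ ^ 2 / ‖x‖ ^ α) (ball 0 R) ∧
      (α - 1) / 2 * (∫ x in ball 0 R, ‖u x‖ ^ 2 / ‖x‖ ^ α)
          + R / 2 * (∫ x, ‖g x‖ ^ 2 / ‖x‖ ^ α ∂(Beltrami.surfaceMeasure R))
        = α * (∫ x in ball 0 R, ‖Beltrami.normalPart u x‖ ^ 2 / ‖x‖ ^ α)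
          + R * (∫ x, ‖Beltrami.normalPart g x‖ ^ 2 / ‖x‖ ^ α ∂(Beltrami.surfaceMeasure R)) ∧
      (α = 1 →
        IntegrableOn (fun x => ‖x‖ * ‖Beltrami.tangentialPart u x‖ ^ 2) (ball 0 R) ∧
        IntegrableOn (fun x => ‖u x‖ ^ 2) (ball 0 R) ∧
        (∫ x in ball 0 R, ‖Beltrami.normalPart u x‖ ^ 2 / ‖x‖)
          = 1 / R ^ 2 * (∫ x in ball 0 R, ‖x‖ * ‖Beltrami.tangentialPart u x‖ ^ 2) ∧
        1 / R ^ 2 * (∫ x in ball 0 R, ‖x‖ * ‖Beltrami.tangentialPart u x‖ ^ 2)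
          = 1 / (2 * R) * (∫ x in ball 0 R, ‖u x‖ ^ 2) ∧
        1 / (2 * R) * (∫ x in ball 0 R, ‖u x‖ ^ 2)
          = 1 / 2 * (∫ x, (‖Beltrami.tangentialPart g x‖ ^ 2 - ‖Beltrami.normalPart g x‖ ^ 2)
              ∂(Beltrami.surfaceMeasure R))) := by
  obtain ⟨G, hW, hu1, hG1, hcurl, hdiv⟩ := hu
  obtain ⟨v, g₀, h₀⟩ := Beltrami.exists_smoothApprox hW hu1 hG1 hR
  have hstress : ∀ᵐ x, Beltrami.stressDiv x (G x) (u x) = 0 := by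
    filter_upwards [hcurl, hdiv] with x hx1 hx2
    exact Beltrami.stressDiv_eq_zero hx2 hx1
  refine ⟨⟨g₀, h₀.isSphereTrace hW⟩, fun g hg => ?_⟩
  -- Any trace agrees almost everywhere with the constructed one, so the same smooth fields converge
  -- to it in `L²`.
  have h := h₀.congr_trace (h₀.ae_eq_of_isSphereTrace hW hg)
  exact ⟨h.memLp_trace, h.integrableOn_norm_sq_div_rpow hα,
    h.integrableOn_normalPart_sq_div_rpow hα, h.power_weight_identity hstress hα,
    fun _ => h.equal_weighted_integrals hstress⟩
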